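/- Notation. For a graph $G$ on $[n]$ with edge set $E(G)$, let $$P_G(x_1,\ldots,x_n)=\frac1{2^{|E(G)|}}\sum_{H\subseteq E(G)}\ \prod_{i\in[n]}\bigl(1+2^{\deg_H(i)}x_i\bigr),$$ where $\deg_H(i)$ is the number of edges in $H$ that contain $i$. Call $G$ a $d$-expander if it is $d$-regular and the second largest absolute value of an eigenvalue of its adjacency matrix (with multiplicity) is at most $d^{0.75}$. For $S\subseteq[n]$ put $x^S=\prod_{i\in S}x_i$. A monotone algebraic circuit is an algebraic circuit over $\mathbb R$ with addition and multiplication gates of fan-in two, all of whose constants are non-negative; its size is the number of its gates (inputs are not counted). A non-negative product pair is a pair $(g,h)$ of multilinear polynomials with non-negative coefficients for which there is a partition of the set of variables into $Y,Z$ with $n/3\le|Y|,|Z|\le 2n/3$, $g\in\mathbb R[Y]$ and $h\in\mathbb R[Z]$. For $k\ge 0$, let $M$ be the random set of edges obtained as follows: start with $M=\emptyset$ and, $k$ times, remove from $G$ all vertices at distance (in $G$) at most $2$ from a vertex of an edge in $M$, and add to $M$ a uniformly random edge of the graph that is left (if there is none, $M$ stays unchanged). Let $\mu_{G,k}$ be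 the law of the set $V(M)$ of end points of the edges in $M$. Theorem. There are an absolute constant $\kappa>0$ and an integer $d_0$ such that for every $d\ge d_0$ the following hold. 1. There are $c>0$ and $n_0$, depending only on $d$, such that for all $n\ge n_0$ and every $d$-expander $G$ on $[n]$, any monotone algebraic circuit computing $P_G$ has size at least $2^{cn}$. 2. For every $\alpha$ with $0<\alpha\le\kappa/d^2$ there are $c>0$ and $n_0$, depending only on $d$ and $\alpha$, such that for all $n\ge n_0$ and every $d$-expander $G$ on $[n]$, with $k=\lfloor\alpha n/2\rfloor$ and $\mu=\mu_{G,k}$: (a) with probability $1$, the random set $M$ consists of exactly $k$ edges of $G$, and end points of different edges of $M$ have distance at least $3$ in $G$; (b) $\mathrm{Coeff}(x^S,P_G)>0$ for every $S\subseteq[n]$; (c) for every non-negative product pair $(g,h)$ with $\mathrm{Coeff}(x^S,gh)\le\mathrm{Coeff}(x^S,P_G)$ for all $S\subseteq[n]$, $$\mathbb E_{S\sim\mu}\left[\frac{\mathrm{Coeff}(x^S,gh)}{\mathrm{Coeff}(x^S,P_G)}\right]\le\exp(-cn).$$ -/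

import Mathlib

/-! ### Algebraic circuits -/

/-- An operand available to a gate that has `s` gates before it: one of the variables
`x_0, …, x_{n-1}`, a real constant, or the output of one of the `s` earlier gates. -/
inductive Operand (n s : ℕ) : Type
  | var (i : Fin n)
  | const (c : ℝ)
  | gate (j : Fin s)

/-- A gate of fan-in two. -/
inductive Gate (n s : ℕ) : Type
  | add (a b : Operand n s)
  | mul (a b : Operand n s)

/-- An algebraic circuit over `ℝ` in `n` variables: a directed acyclic graph of addition and
multiplication gates in topological order (with arbitrary fan-out). The field `size` is the
number of gates; inputs (variables and constants) are not counted. -/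
structure AlgCircuit (n : ℕ) : Type where
  size : ℕ
  gate : (k : Fin size) → Gate n k
  output : Operand n size

noncomputable def Operand.eval {n s : ℕ} (v : Fin s → MvPolynomial (Fin n) ℝ) :
    Operand n s → MvPolynomial (Fin n) ℝ
  | .var i => MvPolynomial.X i
  | .const c => MvPolynomial.C c
  | .gate j => v j

noncomputable def Gate.eval {n s : ℕ} (v : Fin s → MvPolynomial (Fin n) ℝ) :
    Gate n s → MvPolynomial (Fin n) ℝ
  | .add a b => a.eval v + b.eval v
  | .mul a b => a.eval v * b.eval v

/-- The polynomial computed at the `k`-th gate. -/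
noncomputable def AlgCircuit.gateValue {n : ℕ} (C : AlgCircuit n) (k : ℕ) (hk : k < C.size) :
    MvPolynomial (Fin n) ℝ :=
  (C.gate ⟨k, hk⟩).eval fun j => C.gateValue j.1 (lt_trans j.2 hk)
termination_by k
decreasing_by exact j.2

/-- The polynomial computed by the circuit. -/
noncomputable def AlgCircuit.eval {n : ℕ} (C : AlgCircuit n) : MvPolynomial (Fin n) ℝ :=
  C.output.eval fun j => C.gateValue j.1 j.2

def Operand.IsMonotone {n s : ℕ} : Operand n s → Prop
  | .var _ => True
  | .const c => 0 ≤ c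
  | .gate _ => True

def Gate.IsMonotone {n s : ℕ} : Gate n s → Prop
  | .add a b => a.IsMonotone ∧ b.IsMonotone
  | .mul a b => a.IsMonotone ∧ b.IsMonotone

/-- All constants appearing in the circuit are non-negative. -/
def AlgCircuit.IsMonotone {n : ℕ} (C : AlgCircuit n) : Prop :=
  (∀ k, (C.gate k).IsMonotone) ∧ C.output.IsMonotone

/-! ### Polynomials -/

/-- `Coeff(x^S, p)`, where `x^S = ∏ i ∈ S, x_i`. -/
noncomputable def coeffSet {n : ℕ} (S : Finset (Fin n)) (p : MvPolynomial (Fin n) ℝ) : ℝ :=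
  p.coeff (∑ i ∈ S, Finsupp.single i 1)

def IsMultilinear {n : ℕ} (p : MvPolynomial (Fin n) ℝ) : Prop :=
  ∀ i, p.degreeOf i ≤ 1

def HasNonnegCoeffs {n : ℕ} (p : MvPolynomial (Fin n) ℝ) : Prop :=
  ∀ m, 0 ≤ p.coeff m

/-- Multilinear polynomials `g, h` with non-negative coefficients such that the variables can be
partitioned into `Y` and `Z` with `n/3 ≤ |Y|, |Z| ≤ 2n/3`, `g ∈ ℝ[Y]` and `h ∈ ℝ[Z]`. -/
def IsNonnegProductPair {n : ℕ} (g h : MvPolynomial (Fin n) ℝ) : Prop :=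
  IsMultilinear g ∧ IsMultilinear h ∧ HasNonnegCoeffs g ∧ HasNonnegCoeffs h ∧
    ∃ Y Z : Finset (Fin n), Disjoint Y Z ∧ Y ∪ Z = Finset.univ ∧
      (n : ℝ) / 3 ≤ Y.card ∧ (Y.card : ℝ) ≤ 2 * n / 3 ∧
      (n : ℝ) / 3 ≤ Z.card ∧ (Z.card : ℝ) ≤ 2 * n / 3 ∧
      g.vars ⊆ Y ∧ h.vars ⊆ Z

/-- The degree of the vertex `i` in the subgraph with edge set `H`. -/
def edgeSetDegree {n : ℕ} (H : Finset (Sym2 (Fin n))) (i : Fin n) : ℕ :=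
  (H.filter fun e => i ∈ e).card

/-- The average of `∏ i, (1 + 2 ^ deg_H(i) * x_i)` over all `2 ^ |E(G)|` spanning subgraphs `H`
of `G`. -/
noncomputable def hardPoly {n : ℕ} (G : SimpleGraph (Fin n)) [DecidableRel G.Adj] :
    MvPolynomial (Fin n) ℝ :=
  MvPolynomial.C (1 / 2 ^ G.edgeFinset.card : ℝ) *
    ∑ H ∈ G.edgeFinset.powerset,
      ∏ i : Fin n, (1 + MvPolynomial.C (2 ^ edgeSetDegree H i : ℝ) * MvPolynomial.X i)

/-! ### Expanders -/

/-- The second largest absolute value of an eigenvalue of the adjacency matrix, counted with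
multiplicity, is at most `lam`: all eigenvalues but one have absolute value at most `lam`. -/
def SecondEigenvalueLE {n : ℕ} (G : SimpleGraph (Fin n)) [DecidableRel G.Adj] (lam : ℝ) : Prop :=
  ∃ i₀ : Fin n, ∀ i, i ≠ i₀ → |(G.isHermitian_adjMatrix (R := ℝ)).eigenvalues i| ≤ lam

/-- `G` is `d`-regular with second largest eigenvalue (in absolute value) at most `d ^ 0.75`. -/
def IsGoodExpander {n : ℕ} (d : ℕ) (G : SimpleGraph (Fin n)) [DecidableRel G.Adj] : Prop :=
  G.IsRegularOfDegree d ∧ SecondEigenvalueLE G ((d : ℝ) ^ (3 / 4 : ℝ))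

/-! ### The random matching -/

/-- `V(M)`, the set of end points of the edges in `M`. -/
def vertexSet {n : ℕ} (M : Finset (Sym2 (Fin n))) : Finset (Fin n) :=
  Finset.univ.filter fun v => ∃ e ∈ M, v ∈ e

open Classical in
/-- The edges of the graph that is left when all vertices at distance at most `2` in `G` from a
vertex of `M` are removed from `G`. -/
noncomputable def availableEdges {n : ℕ} (G : SimpleGraph (Fin n)) [DecidableRel G.Adj]
    (M : Finset (Sym2 (Fin n))) : Finset (Sym2 (Fin n)) :=
  G.edgeFinset.filter fun e => ∀ v ∈ e, ∀ u ∈ vertexSet M, ¬ G.edist u v ≤ 2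

open Classical in
/-- The random set of edges obtained by `k` times adding a uniformly random available edge,
starting from `∅`. (A step with no available edge changes nothing.) -/
noncomputable def sampleMatching {n : ℕ} (G : SimpleGraph (Fin n)) [DecidableRel G.Adj] :
    ℕ → PMF (Finset (Sym2 (Fin n)))
  | 0 => PMF.pure ∅
  | k + 1 => (sampleMatching G k).bind fun M =>
      if h : (availableEdges G M).Nonempty then
        (PMF.uniformOfFinset (availableEdges G M) h).map fun e => insert e M
      else PMF.pure M

/-- The law of `V(M)` for the random matching `M` with `k` edges. -/
noncomputable def sampleVertexSet {n : ℕ} (G : SimpleGraph (Fin n)) [DecidableRel G.Adj]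
    (k : ℕ) : PMF (Finset (Fin n)) :=
  (sampleMatching G k).map vertexSet

/-- A set of edges of `G` such that end points of different edges have distance at least `3`
in `G`. -/
def IsDistanceThreeMatching {n : ℕ} (G : SimpleGraph (Fin n)) (M : Finset (Sym2 (Fin n))) : Prop :=
  (∀ e ∈ M, e ∈ G.edgeSet) ∧
    ∀ e ∈ M, ∀ f ∈ M, e ≠ f → ∀ u ∈ e, ∀ v ∈ f, 3 ≤ G.edist u v

/-- The expectation of `F S` for `S` drawn from `μ`. -/
noncomputable def expectation {n : ℕ} (μ : PMF (Finset (Fin n))) (F : Finset (Fin n) → ℝ) : ℝ :=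
  ∑ S : Finset (Fin n), (μ S).toReal * F S

/-! ### Decomposing monotone circuits into product pairs -/

namespace HasNonnegCoeffs

variable {n : ℕ} {p q : MvPolynomial (Fin n) ℝ}

/-! The coefficient of `x^S` in `P_G` is a product over the edges of `G`, where an edge contributes
`1`, `3/2` or `5/2` according to the number of its end points in `S` (`coeffSet_hardPoly`). Because
`(3/2)² < 1 · 5/2`, the two ends of an edge are correlated, and a product pair cannot see this
correlation across its partition.

Let `(g, h)` be a dominated product pair with parts `Y` and `Yᶜ`, and let `S = V(M)`, `S' = V(M')`
be independent samples. Exchanging the parts of `S` and `S'` outside `Y` does not change the product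
of the two coefficients of `g * h`. By domination, the product of the ratios at `S` and `S'` is at
most the product of the coefficients of `P_G` at the two mixed sets, divided by the product at `S`
and `S'`. An edge of `M'` that crosses the cut and misses `S` contributes `9/10` to this quotient.
Only edges of `G` between `S'` and `S` can spoil this, at a cost of `10/9` per orientation, and
since the edges of `M` are far apart, an edge of `M'` accounts for at most four orientations
(`coeffSet_mixSet_le`).

Now fix `M` and reveal `M'` edge by edge. By expander mixing (`expander_cut_lower_bound`) a constant
fraction of all edges cross the cut, while for `k = O(n/d²)` few edges are blocked or close to `M`.
So each step multiplies the mean weight by at most `99/100` (`sum_crossWeight_le`), and the squared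
expectation is at most `(99/100)^k` (`sq_expectation_le`).

For circuits, one repeatedly takes a gate depending on between one and two thirds of the variables,
splits off its contribution to the output as a product pair, and replaces the gate by `0`. This
writes `P_G` as a sum of at most `s + 1` pairs, each dominated by `P_G` since nothing cancels. Their
ratios add up to `1` at every `S`, so `1 ≤ (s + 1) exp(-cn)`. -/

theorem zero : HasNonnegCoeffs (0 : MvPolynomial (Fin n) ℝ) := fun m => by simp

theorem const {c : ℝ} (hc : 0 ≤ c) : HasNonnegCoeffs (MvPolynomial.C c : MvPolynomial (Fin n) ℝ) :=
  fun m => by rw [MvPolynomial.coeff_C]; split_ifs <;> simp [hc]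

theorem one : HasNonnegCoeffs (1 : MvPolynomial (Fin n) ℝ) :=
  const (n := n) zero_le_one

theorem var (i : Fin n) : HasNonnegCoeffs (MvPolynomial.X i : MvPolynomial (Fin n) ℝ) :=
  fun m => by classical rw [MvPolynomial.coeff_X]; split_ifs <;> simp

theorem add (hp : HasNonnegCoeffs p) (hq : HasNonnegCoeffs q) : HasNonnegCoeffs (p + q) :=
  fun m => by rw [MvPolynomial.coeff_add]; exact add_nonneg (hp m) (hq m)

theorem mul (hp : HasNonnegCoeffs p) (hq : HasNonnegCoeffs q) : HasNonnegCoeffs (p * q) :=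
  fun m => by
    classical
    rw [MvPolynomial.coeff_mul]
    exact Finset.sum_nonneg fun x _ => mul_nonneg (hp _) (hq _)

end HasNonnegCoeffs

/-- A summand of a multilinear polynomial is multilinear when all coefficients are
non-negative. -/
theorem IsMultilinear.of_add {n : ℕ} {p q : MvPolynomial (Fin n) ℝ} (h : IsMultilinear (p + q))
    (hp : HasNonnegCoeffs p) (hq : HasNonnegCoeffs q) : IsMultilinear p := by
  intro i
  rw [MvPolynomial.degreeOf_le_iff]
  intro m hm
  refine MvPolynomial.degreeOf_le_iff.1 (h i) m ?_
  rw [MvPolynomial.mem_support_iff] at hm ⊢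
  rw [MvPolynomial.coeff_add]
  have := lt_of_le_of_ne (hp m) (Ne.symm hm)
  exact (add_pos_of_pos_of_nonneg this (hq m)).ne'

/-- The factors of a nonzero multilinear product are multilinear in disjoint sets of
variables. -/
theorem IsMultilinear.of_mul {n : ℕ} {p q : MvPolynomial (Fin n) ℝ} (h : IsMultilinear (p * q))
    (hp : p ≠ 0) (hq : q ≠ 0) : IsMultilinear p ∧ IsMultilinear q ∧ Disjoint p.vars q.vars := by
  have key : ∀ i, p.degreeOf i + q.degreeOf i ≤ 1 := fun i => by
    rw [← MvPolynomial.degreeOf_mul_eq hp hq]; exact h i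
  refine ⟨fun i => by have := key i; omega, fun i => by have := key i; omega, ?_⟩
  rw [Finset.disjoint_left]
  intro i hi hi'
  rw [MvPolynomial.mem_vars_iff_degreeOf_ne_zero] at hi hi'
  have := key i
  omega

/-! ### Circuits with some gates replaced by zero -/

namespace AlgCircuit

variable {n : ℕ} (C : AlgCircuit n)

/-- The value of the `k`-th gate when the gates in `Z` are replaced by the constant `0`. -/
noncomputable def maskedValue (C : AlgCircuit n) (Z : Finset ℕ) (k : ℕ) (hk : k < C.size) :
    MvPolynomial (Fin n) ℝ :=
  if k ∈ Z then 0 else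
    (C.gate ⟨k, hk⟩).eval fun j => C.maskedValue Z j.1 (lt_trans j.2 hk)
termination_by k
decreasing_by exact j.2

/-- The value of the output when the gates in `Z` are replaced by the constant `0`. -/
noncomputable def maskedEval (Z : Finset ℕ) : MvPolynomial (Fin n) ℝ :=
  C.output.eval fun j => C.maskedValue Z j.1 j.2

theorem maskedValue_of_mem {Z : Finset ℕ} {k : ℕ} (hk : k < C.size) (h : k ∈ Z) :
    C.maskedValue Z k hk = 0 := by
  rw [maskedValue, if_pos h]

theorem maskedValue_of_notMem {Z : Finset ℕ} {k : ℕ} (hk : k < C.size) (h : k ∉ Z) :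
    C.maskedValue Z k hk =
      (C.gate ⟨k, hk⟩).eval fun j => C.maskedValue Z j.1 (lt_trans j.2 hk) := by
  rw [maskedValue, if_neg h]

theorem maskedValue_empty (k : ℕ) (hk : k < C.size) :
    C.maskedValue ∅ k hk = C.gateValue k hk := by
  induction k using Nat.strong_induction_on with
  | _ k ih =>
    rw [C.maskedValue_of_notMem hk (Finset.notMem_empty k), gateValue]
    congr 1
    funext j
    exact ih j.1 j.2 _

theorem maskedEval_empty : C.maskedEval ∅ = C.eval := by
  simp only [maskedEval, eval, maskedValue_empty]

end AlgCircuit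

theorem Operand.IsMonotone.eval_nonneg {n s : ℕ} {a : Operand n s} (ha : a.IsMonotone)
    {v : Fin s → MvPolynomial (Fin n) ℝ} (hv : ∀ j, HasNonnegCoeffs (v j)) :
    HasNonnegCoeffs (a.eval v) := by
  cases a with
  | var i => exact .var i
  | const c => exact .const ha
  | gate j => exact hv j

theorem Gate.IsMonotone.eval_nonneg {n s : ℕ} {a : Gate n s} (ha : a.IsMonotone)
    {v : Fin s → MvPolynomial (Fin n) ℝ} (hv : ∀ j, HasNonnegCoeffs (v j)) :
    HasNonnegCoeffs (a.eval v) := by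
  cases a with
  | add a b => exact (ha.1.eval_nonneg hv).add (ha.2.eval_nonneg hv)
  | mul a b => exact (ha.1.eval_nonneg hv).mul (ha.2.eval_nonneg hv)

/-- `p = q + r * g` for some `r` with non-negative coefficients. -/
def NonnegAffine {n : ℕ} (g p q : MvPolynomial (Fin n) ℝ) : Prop :=
  ∃ r, HasNonnegCoeffs r ∧ p = q + r * g

theorem NonnegAffine.refl {n : ℕ} (g p : MvPolynomial (Fin n) ℝ) : NonnegAffine g p p :=
  ⟨0, .zero, by simp⟩

theorem Operand.eval_affine {n s : ℕ} (a : Operand n s) {g : MvPolynomial (Fin n) ℝ}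
    {v w : Fin s → MvPolynomial (Fin n) ℝ} (h : ∀ j, NonnegAffine g (v j) (w j)) :
    NonnegAffine g (a.eval v) (a.eval w) := by
  cases a with
  | var i => exact .refl _ _
  | const c => exact .refl _ _
  | gate j => exact h j

/-- Expand `(q₁ + r₁ g)(q₂ + r₂ g)`. The quotient may itself involve `g`, as in the term `r₁ r₂ g`;
only its non-negativity matters here. -/
theorem Gate.IsMonotone.eval_affine {n s : ℕ} {a : Gate n s} (ha : a.IsMonotone)
    {g : MvPolynomial (Fin n) ℝ} (hg : HasNonnegCoeffs g)
    {v w : Fin s → MvPolynomial (Fin n) ℝ} (hw : ∀ j, HasNonnegCoeffs (w j))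
    (h : ∀ j, NonnegAffine g (v j) (w j)) :
    NonnegAffine g (a.eval v) (a.eval w) := by
  cases a with
  | add a b =>
    obtain ⟨r, hr, er⟩ := a.eval_affine h
    obtain ⟨t, ht, et⟩ := b.eval_affine h
    exact ⟨r + t, hr.add ht, by simp only [Gate.eval, er, et]; ring⟩
  | mul a b =>
    obtain ⟨r, hr, er⟩ := a.eval_affine h
    obtain ⟨t, ht, et⟩ := b.eval_affine h
    exact ⟨r * b.eval w + a.eval w * t + r * t * g,
      ((hr.mul (ha.2.eval_nonneg hw)).add ((ha.1.eval_nonneg hw).mul ht)).add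
        ((hr.mul ht).mul hg),
      by simp only [Gate.eval, er, et]; ring⟩

theorem Operand.card_vars_eval {n s : ℕ} (a : Operand n s) (v : Fin s → MvPolynomial (Fin n) ℝ)
    (h : 1 < (a.eval v).vars.card) : ∃ j, a.eval v = v j := by
  cases a with
  | var i => simp [Operand.eval] at h
  | const c => simp [Operand.eval] at h
  | gate j => exact ⟨j, rfl⟩

/-- With fan-in two, one operand carries at least half of the variables. More than two variables in
total force that operand to be a gate, as an input has at most one. -/
theorem Gate.card_vars_eval {n s : ℕ} (a : Gate n s) (v : Fin s → MvPolynomial (Fin n) ℝ)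
    (h : 2 < (a.eval v).vars.card) : ∃ j, (a.eval v).vars.card ≤ 2 * (v j).vars.card := by
  have key : ∀ b c : Operand n s, (a.eval v).vars ⊆ (b.eval v).vars ∪ (c.eval v).vars →
      ∃ j, (a.eval v).vars.card ≤ 2 * (v j).vars.card := by
    intro b c hbc
    have h1 := (Finset.card_le_card hbc).trans (Finset.card_union_le _ _)
    rcases le_total (b.eval v).vars.card (c.eval v).vars.card with h2 | h2
    · obtain ⟨j, hj⟩ := c.card_vars_eval v (by omega)
      exact ⟨j, by rw [← hj]; omega⟩
    · obtain ⟨j, hj⟩ := b.card_vars_eval v (by omega)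
      exact ⟨j, by rw [← hj]; omega⟩
  cases a with
  | add b c => exact key b c (MvPolynomial.vars_add_subset _ _)
  | mul b c => exact key b c (MvPolynomial.vars_mul _ _)

namespace AlgCircuit

variable {n : ℕ} {C : AlgCircuit n}

theorem IsMonotone.maskedValue_nonneg (hC : C.IsMonotone) (Z : Finset ℕ) (k : ℕ)
    (hk : k < C.size) : HasNonnegCoeffs (C.maskedValue Z k hk) := by
  induction k using Nat.strong_induction_on with
  | _ k ih =>
    by_cases h : k ∈ Z
    · rw [C.maskedValue_of_mem hk h]; exact .zero
    · rw [C.maskedValue_of_notMem hk h]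
      exact (hC.1 ⟨k, hk⟩).eval_nonneg fun j => ih j.1 j.2 _

theorem IsMonotone.maskedEval_nonneg (hC : C.IsMonotone) (Z : Finset ℕ) :
    HasNonnegCoeffs (C.maskedEval Z) :=
  hC.2.eval_nonneg fun _ => hC.maskedValue_nonneg Z _ _

/-- Zeroing gate `k` removes a non-negative multiple of its value from every gate. At `k` itself the
multiplier is `1`, and later gates inherit the property. -/
theorem IsMonotone.maskedValue_affine (hC : C.IsMonotone) (Z : Finset ℕ) {k : ℕ}
    (hk : k < C.size) (j : ℕ) (hj : j < C.size) :
    NonnegAffine (C.maskedValue Z k hk) (C.maskedValue Z j hj)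
      (C.maskedValue (insert k Z) j hj) := by
  induction j using Nat.strong_induction_on with
  | _ j ih =>
    by_cases hjk : j = k
    · subst hjk
      exact ⟨1, .one, by rw [C.maskedValue_of_mem hj (Finset.mem_insert_self j Z)]; ring⟩
    by_cases h : j ∈ Z
    · rw [C.maskedValue_of_mem hj h, C.maskedValue_of_mem hj (Finset.mem_insert_of_mem h)]
      exact .refl _ _
    · rw [C.maskedValue_of_notMem hj h, C.maskedValue_of_notMem (Z := insert k Z) hj
        (by simp [hjk, h])]
      exact (hC.1 ⟨j, hj⟩).eval_affine (hC.maskedValue_nonneg Z _ _)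
        (fun i => hC.maskedValue_nonneg _ _ _) fun i => ih i.1 i.2 _

theorem IsMonotone.maskedEval_affine (hC : C.IsMonotone) (Z : Finset ℕ) {k : ℕ}
    (hk : k < C.size) :
    NonnegAffine (C.maskedValue Z k hk) (C.maskedEval Z) (C.maskedEval (insert k Z)) :=
  C.output.eval_affine fun j => hC.maskedValue_affine Z hk j.1 j.2

/-- Descend to an operand with at least half of the variables. The number of variables at most
halves in each step, so it cannot jump from above `2n/3` to below `n/3`. -/
theorem exists_balanced_gate_of_gate (hn : 3 ≤ n) (Z : Finset ℕ) (k : ℕ) (hk : k < C.size)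
    (h : 2 * n < 3 * (C.maskedValue Z k hk).vars.card) :
    ∃ (j : ℕ) (hj : j < C.size), j ∉ Z ∧ n ≤ 3 * (C.maskedValue Z j hj).vars.card ∧
      3 * (C.maskedValue Z j hj).vars.card ≤ 2 * n := by
  induction k using Nat.strong_induction_on with
  | _ k ih =>
    by_cases hkZ : k ∈ Z
    · rw [C.maskedValue_of_mem hk hkZ] at h
      simp at h
    rw [C.maskedValue_of_notMem hk hkZ] at h
    obtain ⟨j, hj⟩ := Gate.card_vars_eval _ _ (show 2 < (Gate.eval (fun j => C.maskedValue Z j.1 (j.2.trans hk))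
      (C.gate ⟨k, hk⟩)).vars.card by omega)
    by_cases h2 : 2 * n < 3 * (C.maskedValue Z j.1 (j.2.trans hk)).vars.card
    · exact ih j.1 j.2 _ h2
    · refine ⟨j.1, j.2.trans hk, fun hjZ => ?_, by omega, by omega⟩
      rw [C.maskedValue_of_mem (j.2.trans hk) hjZ] at hj
      simp at hj
      simp [hj] at h

/-- If the output depends on more than two thirds of the variables, some gate depends on between
one and two thirds of them. -/
theorem exists_balanced_gate (hn : 3 ≤ n) (Z : Finset ℕ)
    (h : 2 * n < 3 * (C.maskedEval Z).vars.card) :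
    ∃ (j : ℕ) (hj : j < C.size), j ∉ Z ∧ n ≤ 3 * (C.maskedValue Z j hj).vars.card ∧
      3 * (C.maskedValue Z j hj).vars.card ≤ 2 * n := by
  obtain ⟨j, hj⟩ := C.output.card_vars_eval (fun j => C.maskedValue Z j.1 j.2)
    (show 1 < (C.maskedEval Z).vars.card by omega)
  refine exists_balanced_gate_of_gate hn Z j.1 j.2 ?_
  rw [← hj]
  exact h

end AlgCircuit

theorem isNonnegProductPair_of_card {n : ℕ} {g h : MvPolynomial (Fin n) ℝ}
    (hg : IsMultilinear g) (hh : IsMultilinear h) (hg0 : HasNonnegCoeffs g)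
    (hh0 : HasNonnegCoeffs h) (Y : Finset (Fin n)) (h1 : n ≤ 3 * Y.card) (h2 : 3 * Y.card ≤ 2 * n)
    (hgY : g.vars ⊆ Y) (hhY : Disjoint Y h.vars) : IsNonnegProductPair g h := by
  refine ⟨hg, hh, hg0, hh0, Y, Yᶜ, disjoint_compl_right, Finset.union_compl Y, ?_, ?_, ?_, ?_, hgY,
    fun i hi => Finset.mem_compl.2 fun hiY => Finset.disjoint_left.1 hhY hiY hi⟩
  all_goals
    have h3 : Yᶜ.card + Y.card = n := by rw [Finset.card_compl_add_card]; simp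
    have h3' : (Yᶜ.card : ℝ) + Y.card = n := by exact_mod_cast h3
    have h1' : (n : ℝ) ≤ 3 * Y.card := by exact_mod_cast h1
    have h2' : (3 : ℝ) * Y.card ≤ 2 * n := by exact_mod_cast h2
    linarith

/-- A polynomial in at most two thirds of the variables forms a product pair with `1`. -/
theorem isNonnegProductPair_one {n : ℕ} (hn : 3 ≤ n) {g : MvPolynomial (Fin n) ℝ}
    (hg : IsMultilinear g) (hg0 : HasNonnegCoeffs g) (h : 3 * g.vars.card ≤ 2 * n) :
    IsNonnegProductPair g 1 := by
  -- If `g` has few variables, its side is padded to `⌈n/3⌉` variables.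
  obtain ⟨Y, hY, hc⟩ := Finset.exists_superset_card_eq (s := g.vars)
    (n := max g.vars.card ((n + 2) / 3)) (le_max_left _ _) (by simp; omega)
  exact isNonnegProductPair_of_card hg (fun i => by simp [MvPolynomial.degreeOf_one]) hg0 .one Y
    (by omega) (by omega) hY (by simp)

/-- A monotone circuit with `s` gates, `m` of which are active, computes a sum of at most `m + 1`
product pairs if its output is multilinear. -/
theorem AlgCircuit.IsMonotone.exists_masked_decomposition {n : ℕ} {C : AlgCircuit n}
    (hC : C.IsMonotone) (hn : 3 ≤ n) (m : ℕ) (Z : Finset ℕ)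
    (hZ : (Finset.range C.size \ Z).card ≤ m) (hml : IsMultilinear (C.maskedEval Z)) :
    ∃ L : List (MvPolynomial (Fin n) ℝ × MvPolynomial (Fin n) ℝ), L.length ≤ m + 1 ∧
      (∀ p ∈ L, IsNonnegProductPair p.1 p.2) ∧
      C.maskedEval Z = (L.map fun p => p.1 * p.2).sum := by
  induction m generalizing Z with
  | zero =>
    by_cases h : 2 * n < 3 * (C.maskedEval Z).vars.card
    · obtain ⟨j, hj, hjZ, -⟩ := C.exists_balanced_gate hn Z h
      have := Finset.card_pos.2 ⟨j, Finset.mem_sdiff.2 ⟨Finset.mem_range.2 hj, hjZ⟩⟩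
      omega
    · exact ⟨[(C.maskedEval Z, 1)], by simp,
        by simpa using isNonnegProductPair_one hn hml (hC.maskedEval_nonneg Z) (by omega),
        by simp⟩
  | succ m ih =>
    by_cases h : 2 * n < 3 * (C.maskedEval Z).vars.card
    · obtain ⟨j, hj, hjZ, h1, h2⟩ := C.exists_balanced_gate hn Z h
      have hjmem : j ∈ Finset.range C.size \ Z :=
        Finset.mem_sdiff.2 ⟨Finset.mem_range.2 hj, hjZ⟩
      have hcard : (Finset.range C.size \ insert j Z).card ≤ m := by
        rw [Finset.sdiff_insert, Finset.card_erase_of_mem hjmem]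
        omega
      obtain ⟨r, hr, e⟩ := hC.maskedEval_affine Z hj
      have hg := hC.maskedValue_nonneg Z j hj
      have hml' := hml
      rw [e] at hml'
      -- Output = (output without gate `j`) + `r` times the value of gate `j`. The first summand is
      -- still multilinear because nothing cancels.
      obtain ⟨L, hL, hLp, hLs⟩ := ih (insert j Z) hcard
        (hml'.of_add (hC.maskedEval_nonneg _) (hr.mul hg))
      -- Degrees add up only for nonzero factors, so disjointness of the variables of `r` and the
      -- gate needs `r ≠ 0`.
      by_cases hr0 : r = 0
      · exact ⟨L, by omega, hLp, by rw [e, hr0, hLs]; ring⟩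
      have hg0 : C.maskedValue Z j hj ≠ 0 := by
        intro h0
        rw [h0] at h1
        simp at h1
        omega
      rw [add_comm] at hml'
      obtain ⟨m1, m2, hd⟩ := (hml'.of_add (hr.mul hg) (hC.maskedEval_nonneg _)).of_mul hr0 hg0
      refine ⟨(C.maskedValue Z j hj, r) :: L, by simp; omega, ?_, ?_⟩
      · intro p hp
        rcases List.mem_cons.1 hp with rfl | hp
        · exact isNonnegProductPair_of_card m2 m1 hg hr _ h1 h2 subset_rfl hd.symm
        · exact hLp p hp
      · rw [e, hLs, List.map_cons, List.sum_cons]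
        ring
    · exact ⟨[(C.maskedEval Z, 1)], by simp,
        by simpa using isNonnegProductPair_one hn hml (hC.maskedEval_nonneg Z) (by omega),
        by simp⟩

/-- A multilinear polynomial computed by a monotone circuit of size `s` is a sum of at most
`s + 1` product pairs. -/
theorem AlgCircuit.IsMonotone.exists_decomposition {n : ℕ} {C : AlgCircuit n}
    (hC : C.IsMonotone) (hn : 3 ≤ n) (hml : IsMultilinear C.eval) :
    ∃ L : List (MvPolynomial (Fin n) ℝ × MvPolynomial (Fin n) ℝ), L.length ≤ C.size + 1 ∧
      (∀ p ∈ L, IsNonnegProductPair p.1 p.2) ∧ C.eval = (L.map fun p => p.1 * p.2).sum := by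
  rw [← C.maskedEval_empty] at hml ⊢
  exact hC.exists_masked_decomposition hn C.size ∅ (by simp) hml

/-! ### Coefficients -/

/-- The factor `(1 + 2 ^ |e ∩ S|) / 2` that the edge `e` contributes to the coefficient of
`x^S`. -/
noncomputable def edgeFactor {n : ℕ} (S : Finset (Fin n)) (e : Sym2 (Fin n)) : ℝ :=
  (1 + 2 ^ (S.filter (· ∈ e)).card) / 2

theorem edgeFactor_pos {n : ℕ} (S : Finset (Fin n)) (e : Sym2 (Fin n)) : 0 < edgeFactor S e := by
  unfold edgeFactor
  positivity

theorem sum_single_apply {n : ℕ} (S : Finset (Fin n)) (i : Fin n) :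
    (∑ j ∈ S, Finsupp.single j 1 : Fin n →₀ ℕ) i = if i ∈ S then 1 else 0 := by
  simp [Finsupp.finsetSum_apply, Finsupp.single_apply]

theorem sum_single_injective {n : ℕ} :
    Function.Injective fun S : Finset (Fin n) => (∑ j ∈ S, Finsupp.single j 1 : Fin n →₀ ℕ) := by
  intro S T h
  ext i
  have := DFunLike.congr_fun h i
  simp only [sum_single_apply] at this
  by_cases h1 : i ∈ S <;> by_cases h2 : i ∈ T <;> simp_all

theorem coeffSet_add {n : ℕ} (S : Finset (Fin n)) (p q : MvPolynomial (Fin n) ℝ) :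
    coeffSet S (p + q) = coeffSet S p + coeffSet S q :=
  MvPolynomial.coeff_add _ _ _

theorem coeffSet_prod_one_add {n : ℕ} (S : Finset (Fin n)) (a : Fin n → ℝ) :
    coeffSet S (∏ i, (1 + MvPolynomial.C (a i) * MvPolynomial.X i)) = ∏ i ∈ S, a i := by
  classical
  rw [Finset.prod_one_add, coeffSet, MvPolynomial.coeff_sum]
  have h : ∀ T : Finset (Fin n), ∏ i ∈ T, (MvPolynomial.C (a i) * MvPolynomial.X i) =
      MvPolynomial.monomial (∑ j ∈ T, Finsupp.single j 1) (∏ i ∈ T, a i) := by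
    intro T
    rw [MvPolynomial.monomial_sum_prod]
    exact Finset.prod_congr rfl fun i _ => by rw [MvPolynomial.C_mul_X_eq_monomial]
  simp only [h, MvPolynomial.coeff_monomial]
  rw [Finset.sum_eq_single S (fun T _ hT => if_neg fun e => hT (sum_single_injective e))
    (by simp), if_pos rfl]

/-- Double counting turns `∏ i ∈ S, 2 ^ deg_H(i)` into a product over the edges of `H`. The sum over
all `H` then factors into one term `1 + 2 ^ |e ∩ S|` per edge. -/
theorem coeffSet_hardPoly {n : ℕ} (G : SimpleGraph (Fin n)) [DecidableRel G.Adj]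
    (S : Finset (Fin n)) : coeffSet S (hardPoly G) = ∏ e ∈ G.edgeFinset, edgeFactor S e := by
  have h : ∀ H : Finset (Sym2 (Fin n)), ∏ i ∈ S, (2 ^ edgeSetDegree H i : ℝ) =
      ∏ e ∈ H, 2 ^ (S.filter (· ∈ e)).card := by
    intro H
    rw [Finset.prod_pow_eq_pow_sum, Finset.prod_pow_eq_pow_sum]
    congr 1
    exact Finset.sum_card_bipartiteAbove_eq_sum_card_bipartiteBelow
      (fun (i : Fin n) (e : Sym2 (Fin n)) => i ∈ e)
  rw [hardPoly, coeffSet, MvPolynomial.coeff_C_mul, MvPolynomial.coeff_sum]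
  have h2 := fun H => (coeffSet_prod_one_add S fun i => (2 ^ edgeSetDegree H i : ℝ)).trans (h H)
  simp only [coeffSet] at h2
  simp only [h2, ← Finset.prod_one_add, edgeFactor, Finset.prod_div_distrib, Finset.prod_const]
  ring

theorem coeffSet_hardPoly_pos {n : ℕ} (G : SimpleGraph (Fin n)) [DecidableRel G.Adj]
    (S : Finset (Fin n)) : 0 < coeffSet S (hardPoly G) := by
  rw [coeffSet_hardPoly]
  exact Finset.prod_pos fun e _ => edgeFactor_pos S e

theorem isMultilinear_hardPoly {n : ℕ} (G : SimpleGraph (Fin n)) [DecidableRel G.Adj] :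
    IsMultilinear (hardPoly G) := by
  classical
  intro i
  refine (MvPolynomial.degreeOf_C_mul_le _ _ _).trans <|
    (MvPolynomial.degreeOf_sum_le _ _ _).trans <| Finset.sup_le fun H _ =>
      (MvPolynomial.degreeOf_prod_le _ _ _).trans ?_
  calc _ ≤ ∑ j : Fin n, if i = j then 1 else 0 := by
        refine Finset.sum_le_sum fun j _ => (MvPolynomial.degreeOf_add_le _ _ _).trans ?_
        rw [MvPolynomial.degreeOf_one]
        refine max_le (Nat.zero_le _) ((MvPolynomial.degreeOf_C_mul_le _ _ _).trans ?_)
        rw [MvPolynomial.degreeOf_X]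
    _ = 1 := by simp

theorem coeff_eq_zero_of_notMem_vars {n : ℕ} {p : MvPolynomial (Fin n) ℝ} {m : Fin n →₀ ℕ}
    {i : Fin n} (hi : i ∉ p.vars) (hm : m i ≠ 0) : p.coeff m = 0 := by
  by_contra h
  exact hi ((MvPolynomial.mem_vars_iff_mem_support i).2
    ⟨m, MvPolynomial.mem_support_iff.2 h, Finsupp.mem_support_iff.2 hm⟩)

/-- The coefficients of a product of polynomials in disjoint sets of variables. -/
theorem coeffSet_mul {n : ℕ} {g h : MvPolynomial (Fin n) ℝ} {Y Z : Finset (Fin n)}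
    (hd : Disjoint Y Z) (hu : Y ∪ Z = Finset.univ) (hg : g.vars ⊆ Y) (hh : h.vars ⊆ Z)
    (S : Finset (Fin n)) : coeffSet S (g * h) = coeffSet (S ∩ Y) g * coeffSet (S ∩ Z) h := by
  classical
  have hYZ : ∀ i, i ∉ Y → i ∈ Z := fun i hi => by
    have : i ∈ Y ∪ Z := hu ▸ Finset.mem_univ i
    exact (Finset.mem_union.1 this).resolve_left hi
  have hZY : ∀ i, i ∈ Y → i ∉ Z := fun i hi => Finset.disjoint_left.1 hd hi
  rw [coeffSet, MvPolynomial.coeff_mul]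
  rw [Finset.sum_eq_single
    ((∑ j ∈ S ∩ Y, Finsupp.single j 1 : Fin n →₀ ℕ), (∑ j ∈ S ∩ Z, Finsupp.single j 1 : Fin n →₀ ℕ))]
  · rfl
  · rintro ⟨a, b⟩ hab hne
    rw [Finset.HasAntidiagonal.mem_antidiagonal] at hab
    by_contra hc
    rw [mul_eq_zero, not_or] at hc
    have ha : ∀ i ∉ Y, a i = 0 := fun i hi => by
      by_contra h0
      exact hc.1 (coeff_eq_zero_of_notMem_vars (fun h' => hi (hg h')) h0)
    have hb : ∀ i ∉ Z, b i = 0 := fun i hi => by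
      by_contra h0
      exact hc.2 (coeff_eq_zero_of_notMem_vars (fun h' => hi (hh h')) h0)
    have hs : ∀ i, a i + b i = if i ∈ S then 1 else 0 := fun i => by
      rw [← sum_single_apply, ← hab, Finsupp.add_apply]
    apply hne
    rw [Prod.mk.injEq]
    constructor
    · ext i
      rw [sum_single_apply]
      have := hs i
      by_cases hi : i ∈ Y
      · rw [hb i (hZY i hi)] at this
        simpa [hi] using this
      · simp [hi, ha i hi]
    · ext i
      rw [sum_single_apply]
      have := hs i
      by_cases hi : i ∈ Y
      · simp [hZY i hi, hb i (hZY i hi)]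
      · rw [ha i hi] at this
        simpa [hYZ i hi] using this
  · intro h
    refine absurd (Finset.HasAntidiagonal.mem_antidiagonal.2 ?_) h
    rw [← Finset.sum_union (hd.mono Finset.inter_subset_right Finset.inter_subset_right),
      ← Finset.inter_union_distrib_left, hu, Finset.inter_univ]

/-! ### Edges across a balanced partition of an expander -/

open Matrix in
theorem Matrix.IsHermitian.inner_eigenvectorBasis_mulVec {n : ℕ} {A : Matrix (Fin n) (Fin n) ℝ}
    (hA : A.IsHermitian) (i : Fin n) (x : EuclideanSpace ℝ (Fin n)) :
    inner ℝ (hA.eigenvectorBasis i) (WithLp.toLp 2 (A *ᵥ x.ofLp)) =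
      hA.eigenvalues i * inner ℝ (hA.eigenvectorBasis i) x := by
  have h1 : ∀ y z : EuclideanSpace ℝ (Fin n), inner ℝ y z = y.ofLp ⬝ᵥ z.ofLp := fun y z => by
    rw [EuclideanSpace.inner_eq_star_dotProduct, dotProduct_comm]; simp
  have hT : Aᵀ = A := by simpa using hA.eq
  rw [h1, h1, Matrix.dotProduct_mulVec, ← Matrix.mulVec_transpose, hT,
    hA.mulVec_eigenvectorBasis, smul_dotProduct, smul_eq_mul]

open Matrix in
/-- The expander mixing bound for the number of edges between a set and its complement. -/
theorem expander_cut_lower_bound {n : ℕ} (G : SimpleGraph (Fin n)) [DecidableRel G.Adj] {d : ℕ}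
    {lam : ℝ} (hreg : G.IsRegularOfDegree d) (hlam : SecondEigenvalueLE G lam) (hld : lam < d)
    (Y : Finset (Fin n)) :
    (d - lam) * (Y.card * Yᶜ.card) ≤ n * ∑ y ∈ Y, ∑ z ∈ Yᶜ, G.adjMatrix ℝ y z := by
  obtain ⟨i₀, hi₀⟩ := hlam
  set hA := G.isHermitian_adjMatrix (R := ℝ)
  set A := G.adjMatrix ℝ with hAdef
  set b := hA.eigenvectorBasis with hb
  set one : EuclideanSpace ℝ (Fin n) := WithLp.toLp 2 (fun _ => 1) with hone
  set x : EuclideanSpace ℝ (Fin n) := WithLp.toLp 2 (fun i => if i ∈ Y then 1 else 0) with hx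
  have hin : ∀ y z : EuclideanSpace ℝ (Fin n), inner ℝ y z = ∑ i, y i * z i := fun y z => by
    simp [PiLp.inner_apply, mul_comm]
  have hA1 : WithLp.toLp 2 (A *ᵥ one.ofLp) = (d : ℝ) • one := by
    ext i
    simp [hone, hAdef, hreg.degree_eq i]
  -- The all-ones vector has eigenvalue `d > lam`, so it is orthogonal to every eigenvector except
  -- the one at `i₀`.
  have hperp : ∀ i, i ≠ i₀ → inner ℝ (b i) one = 0 := by
    intro i hi
    have h1 := hA.inner_eigenvectorBasis_mulVec i one
    rw [hA1, inner_smul_right] at h1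
    have h2 : (d - hA.eigenvalues i) * inner ℝ (b i) one = 0 := by
      rw [sub_mul, ← h1, sub_self]
    rcases mul_eq_zero.1 h2 with h3 | h3
    · have := (le_abs_self _).trans (hi₀ i hi)
      linarith
    · exact h3
  have hexp : ∀ z : EuclideanSpace ℝ (Fin n),
      inner ℝ one z = inner ℝ one (b i₀) * inner ℝ (b i₀) z := by
    intro z
    rw [← b.sum_inner_mul_inner one z]
    refine Finset.sum_eq_single i₀ (fun i _ hi => ?_) (by simp)
    rw [real_inner_comm, hperp i hi, zero_mul]
  set c := inner ℝ (b i₀) x with hc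
  set t := inner ℝ one (b i₀) with ht
  have htt : t * t = n := by
    have := hexp one
    rw [hin, real_inner_comm one (b i₀)] at this
    simpa [hone] using this.symm
  have htc : t * c = Y.card := by
    rw [← hexp x, hin]
    simp [hone, hx]
  have hcc : (n : ℝ) * (c * c) = Y.card * Y.card := by
    rw [← htt, ← htc]; ring
  have hn0 : (0 : ℝ) < n := by exact_mod_cast (Fin.pos i₀)
  have ht0 : t ≠ 0 := by
    intro h; rw [h] at htt; simp at htt; linarith
  have hev : hA.eigenvalues i₀ = d := by
    have h1 := hA.inner_eigenvectorBasis_mulVec i₀ one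
    rw [hA1, inner_smul_right, real_inner_comm] at h1
    exact (mul_right_cancel₀ ht0 h1).symm
  have hxx : inner ℝ x x = (Y.card : ℝ) := by
    rw [hin]; simp [hx]
  -- In the eigenbasis the direction `i₀` contributes `d c²`, and the other directions at most `lam
  -- (|Y| - c²)`, where `c² = |Y|²/n`.
  have hquad : inner ℝ x (WithLp.toLp 2 (A *ᵥ x.ofLp)) ≤
      (d - lam) * (c * c) + lam * Y.card := by
    rw [← hxx, ← b.sum_inner_mul_inner x x, ← b.sum_inner_mul_inner x (WithLp.toLp 2 _)]
    rw [← Finset.add_sum_erase _ _ (Finset.mem_univ i₀),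
      ← Finset.add_sum_erase _ (fun i => inner ℝ x (b i) * inner ℝ (b i) x) (Finset.mem_univ i₀)]
    have h1 : ∑ i ∈ Finset.univ.erase i₀, inner ℝ x (b i) *
        inner ℝ (b i) (WithLp.toLp 2 (A *ᵥ x.ofLp)) ≤
        lam * ∑ i ∈ Finset.univ.erase i₀, inner ℝ x (b i) * inner ℝ (b i) x := by
      rw [Finset.mul_sum]
      refine Finset.sum_le_sum fun i hi => ?_
      have h2 := (le_abs_self _).trans (hi₀ i (Finset.ne_of_mem_erase hi))
      have h3 := mul_le_mul_of_nonneg_right h2 (mul_self_nonneg (inner ℝ (b i) x))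
      rw [hA.inner_eigenvectorBasis_mulVec, real_inner_comm]
      calc _ = hA.eigenvalues i * (inner ℝ (b i) x * inner ℝ (b i) x) := by ring
        _ ≤ _ := h3
    rw [hA.inner_eigenvectorBasis_mulVec, hev, real_inner_comm (b i₀) x]
    have : (d : ℝ) * inner ℝ (b i₀) x = d * c := rfl
    rw [mul_add]
    have e : inner ℝ (b i₀) x = c := rfl
    rw [e]
    linarith
  have hrow : ∀ y, ∑ z, A y z = d := fun y => by
    have := G.degree_eq_sum_if_adj (R := ℝ) y
    rw [hreg.degree_eq] at this
    simp [hAdef, SimpleGraph.adjMatrix_apply, this]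
  have hq2 : inner ℝ x (WithLp.toLp 2 (A *ᵥ x.ofLp)) = ∑ y ∈ Y, ∑ z ∈ Y, A y z := by
    rw [hin]
    simp [hx, mulVec, dotProduct, Finset.sum_ite_mem]
  have hsplit : ∑ y ∈ Y, ∑ z ∈ Y, A y z + ∑ y ∈ Y, ∑ z ∈ Yᶜ, A y z = Y.card * d := by
    rw [← Finset.sum_add_distrib]
    have h1 : ∀ y ∈ Y, ∑ z ∈ Y, A y z + ∑ z ∈ Yᶜ, A y z = d := fun y _ => by
      rw [Finset.sum_add_sum_compl, hrow]
    rw [Finset.sum_congr rfl h1, Finset.sum_const, nsmul_eq_mul]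
  have hYc : (Yᶜ.card : ℝ) = n - Y.card := by
    have h3 : Yᶜ.card + Y.card = n := by rw [Finset.card_compl_add_card]; simp
    have h4 : (Yᶜ.card : ℝ) + Y.card = n := by exact_mod_cast h3
    linarith
  have hfin : (n : ℝ) * ∑ y ∈ Y, ∑ z ∈ Y, A y z ≤
      (d - lam) * (Y.card * Y.card) + n * (lam * Y.card) := by
    rw [← hcc, ← hq2]
    calc _ ≤ (n : ℝ) * ((d - lam) * (c * c) + lam * Y.card) :=
          mul_le_mul_of_nonneg_left hquad hn0.le
      _ = _ := by ring
  have : (n : ℝ) * ∑ y ∈ Y, ∑ z ∈ Yᶜ, A y z =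
      n * (Y.card * d) - n * ∑ y ∈ Y, ∑ z ∈ Y, A y z := by rw [← hsplit]; ring
  rw [this, hYc]
  linarith

/-! ### The random matching -/

/-- The mean of `F` under a distribution on a finite type. -/
noncomputable def PMF.mean {α : Type*} [Fintype α] (p : PMF α) (F : α → ℝ) : ℝ :=
  ∑ a, (p a).toReal * F a

namespace PMF

variable {α β : Type*} [Fintype α] [Fintype β]

theorem mean_pure [DecidableEq α] (a : α) (F : α → ℝ) : (PMF.pure a).mean F = F a := by
  simp [mean, PMF.pure_apply, apply_ite ENNReal.toReal]

theorem mean_bind (p : PMF α) (f : α → PMF β) (F : β → ℝ) :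
    (p.bind f).mean F = p.mean fun a => (f a).mean F := by
  have h : ∀ b, ((p.bind f) b).toReal = ∑ a, (p a).toReal * (f a b).toReal := fun b => by
    rw [PMF.bind_apply, tsum_fintype, ENNReal.toReal_sum fun a _ =>
      ENNReal.mul_ne_top (p.apply_ne_top a) ((f a).apply_ne_top b)]
    simp [ENNReal.toReal_mul]
  simp only [mean, h, Finset.sum_mul, Finset.mul_sum]
  rw [Finset.sum_comm]
  exact Finset.sum_congr rfl fun a _ => Finset.sum_congr rfl fun b _ => mul_assoc _ _ _

theorem mean_map (p : PMF α) (f : α → β) (F : β → ℝ) : (p.map f).mean F = p.mean (F ∘ f) := by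
  classical
  rw [← PMF.bind_pure_comp, mean_bind]
  simp only [Function.comp_apply, mean_pure]
  rfl

theorem mean_uniformOfFinset {s : Finset α} (hs : s.Nonempty) (F : α → ℝ) :
    (PMF.uniformOfFinset s hs).mean F = (∑ a ∈ s, F a) / s.card := by
  classical
  simp only [mean, PMF.uniformOfFinset_apply, apply_ite ENNReal.toReal, ite_mul]
  simp [Finset.sum_ite_mem, Finset.mul_sum, div_eq_inv_mul]

theorem mean_mono {p : PMF α} {F F' : α → ℝ} (h : ∀ a ∈ p.support, F a ≤ F' a) :
    p.mean F ≤ p.mean F' := by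
  refine Finset.sum_le_sum fun a _ => ?_
  by_cases ha : a ∈ p.support
  · exact mul_le_mul_of_nonneg_left (h a ha) ENNReal.toReal_nonneg
  · rw [PMF.mem_support_iff, not_not] at ha
    simp [ha]

theorem mean_const_mul (p : PMF α) (c : ℝ) (F : α → ℝ) :
    p.mean (fun a => c * F a) = c * p.mean F := by
  simp only [mean, Finset.mul_sum]
  exact Finset.sum_congr rfl fun a _ => by ring

theorem mean_const (p : PMF α) (c : ℝ) : p.mean (fun _ => c) = c := by
  have h := p.tsum_coe
  rw [tsum_fintype] at h
  have h2 : ∑ a, (p a).toReal = 1 := by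
    rw [← ENNReal.toReal_sum fun a _ => p.apply_ne_top a, h, ENNReal.toReal_one]
  rw [mean, ← Finset.sum_mul, h2, one_mul]

end PMF

/-! ### Edge counts in regular graphs and expanders -/

section Counting

variable {n d : ℕ} {G : SimpleGraph (Fin n)} [DecidableRel G.Adj]

theorem SimpleGraph.IsRegularOfDegree.two_mul_card_edgeFinset (hreg : G.IsRegularOfDegree d) :
    2 * G.edgeFinset.card = n * d := by
  rw [← G.sum_degrees_eq_twice_card_edges]
  simp [hreg.degree_eq]

open Classical in
theorem SimpleGraph.IsRegularOfDegree.card_edges_touching_le (hreg : G.IsRegularOfDegree d)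
    (W : Finset (Fin n)) :
    (G.edgeFinset.filter fun e => ∃ v ∈ e, v ∈ W).card ≤ W.card * d := by
  have h : (G.edgeFinset.filter fun e => ∃ v ∈ e, v ∈ W) ⊆
      W.biUnion fun v => G.incidenceFinset v := by
    intro e he
    obtain ⟨he, v, hv, hW⟩ := Finset.mem_filter.1 he
    rw [SimpleGraph.mem_edgeFinset] at he
    exact Finset.mem_biUnion.2 ⟨v, hW, by
      rw [SimpleGraph.mem_incidenceFinset]; exact ⟨he, hv⟩⟩
  refine (Finset.card_le_card h).trans (Finset.card_biUnion_le_card_mul _ _ _ fun v _ => ?_)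
  rw [SimpleGraph.card_incidenceFinset_eq_degree, hreg.degree_eq]

theorem mem_vertexSet {M : Finset (Sym2 (Fin n))} {v : Fin n} :
    v ∈ vertexSet M ↔ ∃ e ∈ M, v ∈ e := by
  simp [vertexSet]

theorem card_vertexSet_le (M : Finset (Sym2 (Fin n))) : (vertexSet M).card ≤ M.card * 2 := by
  have h : vertexSet M ⊆ M.biUnion fun e => e.toFinset := by
    intro v hv
    obtain ⟨e, he, hv⟩ := mem_vertexSet.1 hv
    exact Finset.mem_biUnion.2 ⟨e, he, Sym2.mem_toFinset.2 hv⟩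
  refine (Finset.card_le_card h).trans (Finset.card_biUnion_le_card_mul _ _ _ fun e _ => ?_)
  rw [Sym2.card_toFinset]
  split_ifs <;> omega

open Classical in
theorem SimpleGraph.IsRegularOfDegree.card_ball_two_le (hreg : G.IsRegularOfDegree d)
    (u : Fin n) : (Finset.univ.filter fun v => G.edist u v ≤ 2).card ≤ 1 + d + d * d := by
  have h : (Finset.univ.filter fun v => G.edist u v ≤ 2) ⊆
      ({u} ∪ G.neighborFinset u) ∪ (G.neighborFinset u).biUnion fun w => G.neighborFinset w := by
    intro v hv
    have hv := (Finset.mem_filter.1 hv).2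
    by_contra hc
    simp only [Finset.mem_union, Finset.mem_singleton, Finset.mem_biUnion,
      SimpleGraph.mem_neighborFinset, not_or, not_exists, not_and] at hc
    refine absurd (SimpleGraph.two_lt_edist_iff.2 ⟨fun e => hc.1.1 e.symm, hc.1.2, ?_⟩) hv.not_gt
    rw [Set.eq_empty_iff_forall_notMem]
    intro w hw
    rw [SimpleGraph.mem_commonNeighbors] at hw
    exact hc.2 w hw.1 hw.2.symm
  refine (Finset.card_le_card h).trans ((Finset.card_union_le _ _).trans (add_le_add
    ((Finset.card_union_le _ _).trans (by simp [hreg.degree_eq])) ?_))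
  refine (Finset.card_biUnion_le_card_mul _ _ d fun v _ => by simp [hreg.degree_eq]).trans ?_
  simp [hreg.degree_eq]

/-- Each end point of `M` blocks a ball of at most `1 + d + d² ≤ 3d²` vertices, and each blocked
vertex lies on `d` edges. -/
theorem SimpleGraph.IsRegularOfDegree.card_unavailable_le (hreg : G.IsRegularOfDegree d)
    (hd : 1 ≤ d) (M : Finset (Sym2 (Fin n))) :
    (G.edgeFinset \ availableEdges G M).card ≤ 6 * d ^ 3 * M.card := by
  classical
  set W := (vertexSet M).biUnion fun u => Finset.univ.filter fun v => G.edist u v ≤ 2 with hW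
  have h : G.edgeFinset \ availableEdges G M ⊆ G.edgeFinset.filter fun e => ∃ v ∈ e, v ∈ W := by
    intro e he
    obtain ⟨he, hne⟩ := Finset.mem_sdiff.1 he
    refine Finset.mem_filter.2 ⟨he, ?_⟩
    by_contra hc
    push Not at hc
    refine hne (Finset.mem_filter.2 ⟨he, fun v hv u hu huv => hc v hv ?_⟩)
    exact Finset.mem_biUnion.2 ⟨u, hu, Finset.mem_filter.2 ⟨Finset.mem_univ _, huv⟩⟩
  have hWc : W.card ≤ (M.card * 2) * (1 + d + d * d) :=
    (Finset.card_biUnion_le_card_mul _ _ _ fun u _ => hreg.card_ball_two_le u).trans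
      (Nat.mul_le_mul_right _ (card_vertexSet_le M))
  calc _ ≤ W.card * d := (Finset.card_le_card h).trans (hreg.card_edges_touching_le W)
    _ ≤ (M.card * 2) * (1 + d + d * d) * d := Nat.mul_le_mul_right _ hWc
    _ ≤ (M.card * 2) * (3 * (d * d)) * d := by gcongr; nlinarith
    _ = 6 * d ^ 3 * M.card := by ring

/-- The edge `e` has one end point in `Y` and one outside of `Y`. -/
def Crosses (Y : Finset (Fin n)) (e : Sym2 (Fin n)) : Prop :=
  ∃ y ∈ e, ∃ z ∈ e, y ∈ Y ∧ z ∉ Y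

/-- The edge `e` has an end point that is a neighbour of a vertex of `M`. -/
def Touches (G : SimpleGraph (Fin n)) (M : Finset (Sym2 (Fin n))) (e : Sym2 (Fin n)) : Prop :=
  ∃ v ∈ e, ∃ u ∈ vertexSet M, G.Adj u v

open Classical in
theorem SimpleGraph.IsRegularOfDegree.card_touches_le (hreg : G.IsRegularOfDegree d)
    (M : Finset (Sym2 (Fin n))) :
    (G.edgeFinset.filter (Touches G M)).card ≤ 2 * d ^ 2 * M.card := by
  set W := (vertexSet M).biUnion fun u => G.neighborFinset u with hW
  have h : G.edgeFinset.filter (Touches G M) ⊆ G.edgeFinset.filter fun e => ∃ v ∈ e, v ∈ W := by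
    refine Finset.monotone_filter_right _ fun e _ ⟨v, hv, u, hu, huv⟩ => ⟨v, hv, ?_⟩
    exact Finset.mem_biUnion.2 ⟨u, hu, (G.mem_neighborFinset u v).2 huv⟩
  have hWc : W.card ≤ (M.card * 2) * d :=
    (Finset.card_biUnion_le_card_mul _ _ d fun u _ => by simp [hreg.degree_eq]).trans
      (Nat.mul_le_mul_right _ (card_vertexSet_le M))
  calc _ ≤ W.card * d := (Finset.card_le_card h).trans (hreg.card_edges_touching_le W)
    _ ≤ (M.card * 2) * d * d := Nat.mul_le_mul_right _ hWc
    _ = 2 * d ^ 2 * M.card := by ring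

open Classical in
theorem sum_adjMatrix_le_card_crosses (Y : Finset (Fin n)) :
    ∑ y ∈ Y, ∑ z ∈ Yᶜ, G.adjMatrix ℝ y z ≤ (G.edgeFinset.filter (Crosses Y)).card := by
  have h1 : ∑ y ∈ Y, ∑ z ∈ Yᶜ, G.adjMatrix ℝ y z =
      ((Y ×ˢ Yᶜ).filter fun p => G.Adj p.1 p.2).card := by
    rw [← Finset.sum_product' Y Yᶜ fun y z => G.adjMatrix ℝ y z, Finset.card_filter]
    push_cast
    exact Finset.sum_congr rfl fun p _ => by rw [SimpleGraph.adjMatrix_apply]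
  rw [h1]
  norm_cast
  refine Finset.card_le_card_of_injOn (fun p => s(p.1, p.2)) ?_ ?_
  · rintro ⟨y, z⟩ hp
    simp only [Finset.coe_filter, Finset.mem_product, Finset.mem_compl, Set.mem_ofPred_eq] at hp
    simp only [Finset.coe_filter, SimpleGraph.mem_edgeFinset, SimpleGraph.mem_edgeSet,
      Set.mem_ofPred_eq]
    exact ⟨hp.2, y, Sym2.mem_mk_left y z, z, Sym2.mem_mk_right y z, hp.1⟩
  · rintro ⟨y, z⟩ hp ⟨y', z'⟩ hp' he
    simp only [Finset.coe_filter, Finset.mem_product, Finset.mem_compl, Set.mem_ofPred_eq] at hp hp'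
    rcases Sym2.eq_iff.1 he with ⟨h, h'⟩ | ⟨h, h'⟩
    · exact Prod.ext h h'
    · exact absurd hp'.1.1 ((show z = y' from h') ▸ hp.1.2)

/-- `d^(1/4) ≥ 2` for `d ≥ 16`. All that is used of the exponent `3/4` is the resulting spectral gap
of at least `d/2`. -/
theorem rpow_three_quarters_le (hd : 16 ≤ d) : (d : ℝ) ^ (3 / 4 : ℝ) ≤ d / 2 := by
  have hd' : (16 : ℝ) ≤ d := by exact_mod_cast hd
  have h2 : (2 : ℝ) ≤ (d : ℝ) ^ (1 / 4 : ℝ) := by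
    calc (2 : ℝ) = (16 : ℝ) ^ (1 / 4 : ℝ) := by
          rw [show (16 : ℝ) = 2 ^ (4 : ℝ) by norm_num, ← Real.rpow_mul (by norm_num)]
          norm_num
      _ ≤ _ := Real.rpow_le_rpow (by norm_num) hd' (by norm_num)
  have h3 : (d : ℝ) ^ (3 / 4 : ℝ) * (d : ℝ) ^ (1 / 4 : ℝ) = d := by
    rw [← Real.rpow_add (by linarith)]
    norm_num
  have h4 := mul_le_mul_of_nonneg_left h2 (Real.rpow_nonneg (by linarith : (0 : ℝ) ≤ d) (3 / 4))
  linarith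

open Classical in
/-- In a good expander a constant fraction of the edges cross a balanced partition. -/
theorem IsGoodExpander.card_crosses_ge (hG : IsGoodExpander d G) (hd : 16 ≤ d) (hn : 0 < n)
    {Y : Finset (Fin n)} (h1 : (n : ℝ) / 3 ≤ Y.card) (h2 : (Y.card : ℝ) ≤ 2 * n / 3) :
    (d : ℝ) * n ≤ 9 * (G.edgeFinset.filter (Crosses Y)).card := by
  have hd' : (16 : ℝ) ≤ d := by exact_mod_cast hd
  have hn' : (0 : ℝ) < n := by exact_mod_cast hn
  have hlam := rpow_three_quarters_le hd
  have h3 := expander_cut_lower_bound G hG.1 hG.2 (by linarith) Y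
  have h4 := sum_adjMatrix_le_card_crosses (G := G) Y
  have h5 : (Yᶜ.card : ℝ) = n - Y.card := by
    have h6 : Yᶜ.card + Y.card = n := by rw [Finset.card_compl_add_card]; simp
    have h7 : (Yᶜ.card : ℝ) + Y.card = n := by exact_mod_cast h6
    linarith
  -- A concave function of `|Y|`, smallest at the ends `n/3` and `2n/3`.
  have h6 : 2 * (n : ℝ) * n / 9 ≤ Y.card * Yᶜ.card := by
    rw [h5]
    nlinarith [mul_nonneg (sub_nonneg.2 h1) (sub_nonneg.2 h2)]
  have h7 : (d : ℝ) / 2 * (2 * n * n / 9) ≤ (d - (d : ℝ) ^ (3 / 4 : ℝ)) * (Y.card * Yᶜ.card) :=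
    mul_le_mul (by linarith) h6 (by positivity) (by linarith)
  have h8 := mul_le_mul_of_nonneg_left h4 hn'.le
  refine le_of_mul_le_mul_left ?_ hn'
  linarith

end Counting

open Classical in
/-- The weight of the edge `e` in the comparison of two independent samples. -/
noncomputable def crossWeight {n : ℕ} (G : SimpleGraph (Fin n)) (Y : Finset (Fin n))
    (M : Finset (Sym2 (Fin n))) (e : Sym2 (Fin n)) : ℝ :=
  (if Crosses Y e then 9 / 10 else 1) * (if Touches G M e then (10 / 9) ^ 4 else 1)

theorem crossWeight_nonneg {n : ℕ} (G : SimpleGraph (Fin n)) (Y : Finset (Fin n)) (M : Finset (Sym2 (Fin n))) (e : Sym2 (Fin n)) :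
    0 ≤ crossWeight G Y M e := by
  unfold crossWeight
  positivity

/-! ### The sampling process step by step -/

section Sampling

variable {n d : ℕ} {G : SimpleGraph (Fin n)} [DecidableRel G.Adj]

theorem notMem_of_mem_availableEdges {M : Finset (Sym2 (Fin n))} {e : Sym2 (Fin n)}
    (he : e ∈ availableEdges G M) : e ∉ M := by
  classical
  intro heM
  induction e with
  | _ x y =>
    have hx : x ∈ s(x, y) := Sym2.mem_mk_left x y
    exact (Finset.mem_filter.1 he).2 x hx x (mem_vertexSet.2 ⟨_, heM, hx⟩) (by simp)

theorem mem_support_sampleMatching_succ {k : ℕ} {M' : Finset (Sym2 (Fin n))}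
    (h : M' ∈ (sampleMatching G (k + 1)).support) :
    ∃ M ∈ (sampleMatching G k).support,
      (∃ e ∈ availableEdges G M, M' = insert e M) ∨ (¬ (availableEdges G M).Nonempty ∧ M' = M) := by
  classical
  rw [sampleMatching, PMF.mem_support_bind_iff] at h
  obtain ⟨M, hM, h⟩ := h
  refine ⟨M, hM, ?_⟩
  split_ifs at h with ha
  · rw [PMF.mem_support_map_iff] at h
    obtain ⟨e, he, rfl⟩ := h
    exact .inl ⟨e, (PMF.mem_support_uniformOfFinset_iff ha e).1 he, by congr⟩
  · rw [PMF.mem_support_pure_iff] at h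
    exact .inr ⟨ha, h⟩

theorem card_le_of_mem_support_sampleMatching {k : ℕ} {M : Finset (Sym2 (Fin n))}
    (h : M ∈ (sampleMatching G k).support) : M.card ≤ k := by
  induction k generalizing M with
  | zero =>
    rw [sampleMatching, PMF.mem_support_pure_iff] at h
    simp [h]
  | succ k ih =>
    obtain ⟨M₀, h₀, ⟨e, -, rfl⟩ | ⟨-, rfl⟩⟩ := mem_support_sampleMatching_succ h
    · exact (Finset.card_insert_le _ _).trans (Nat.succ_le_succ (ih h₀))
    · exact (ih h₀).trans (Nat.le_succ k)

theorem card_eq_of_mem_support_sampleMatching {k : ℕ}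
    (hav : ∀ M : Finset (Sym2 (Fin n)), M.card < k → (availableEdges G M).Nonempty)
    {M : Finset (Sym2 (Fin n))} (h : M ∈ (sampleMatching G k).support) : M.card = k := by
  induction k generalizing M with
  | zero => exact Nat.le_zero.1 (card_le_of_mem_support_sampleMatching h)
  | succ k ih =>
    obtain ⟨M₀, h₀, ⟨e, he, rfl⟩ | ⟨hn, -⟩⟩ := mem_support_sampleMatching_succ h
    · rw [Finset.card_insert_of_notMem (notMem_of_mem_availableEdges he),
        ih (fun M hM => hav M (hM.trans (Nat.lt_succ_self k))) h₀]
    · exact absurd (hav M₀ (Nat.lt_succ_of_le (card_le_of_mem_support_sampleMatching h₀))) hn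

theorem isDistanceThreeMatching_of_mem_support {k : ℕ} {M : Finset (Sym2 (Fin n))}
    (h : M ∈ (sampleMatching G k).support) : IsDistanceThreeMatching G M := by
  classical
  induction k generalizing M with
  | zero =>
    rw [sampleMatching, PMF.mem_support_pure_iff] at h
    simp [h, IsDistanceThreeMatching]
  | succ k ih =>
    obtain ⟨M₀, h₀, ⟨e, he, rfl⟩ | ⟨-, rfl⟩⟩ := mem_support_sampleMatching_succ h
    · obtain ⟨hE, hd⟩ := ih h₀
      obtain ⟨heE, hav⟩ := Finset.mem_filter.1 he
      have key : ∀ f ∈ M₀, ∀ u ∈ f, ∀ v ∈ e, 3 ≤ G.edist u v := fun f hf u hu v hv => by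
        have := not_le.1 (hav v hv u (mem_vertexSet.2 ⟨f, hf, hu⟩))
        exact Order.add_one_le_of_lt this
      constructor
      · intro f hf
        rcases Finset.mem_insert.1 hf with rfl | hf
        · exact SimpleGraph.mem_edgeFinset.1 heE
        · exact hE f hf
      · intro f hf f' hf' hne u hu v hv
        rcases Finset.mem_insert.1 hf with rfl | h1 <;>
          rcases Finset.mem_insert.1 hf' with rfl | h2
        · exact absurd rfl hne
        · rw [SimpleGraph.edist_comm]
          exact key f' h2 v hv u hu
        · exact key f h1 u hu v hv
        · exact hd f h1 f' h2 hne u hu v hv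
    · exact ih h₀

/-- If each step multiplies a product weight by at most `ρ` on average, the mean weight after `k`
steps is at most `ρ ^ k`. -/
theorem mean_sampleMatching_prod_le {k : ℕ} {w : Sym2 (Fin n) → ℝ} (hw : ∀ e, 0 ≤ w e) {ρ : ℝ}
    (hρ : 0 ≤ ρ)
    (hstep : ∀ M : Finset (Sym2 (Fin n)), M.card < k → (availableEdges G M).Nonempty ∧
      ∑ e ∈ availableEdges G M, w e ≤ ρ * (availableEdges G M).card) :
    (sampleMatching G k).mean (fun M => ∏ e ∈ M, w e) ≤ ρ ^ k := by
  classical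
  induction k with
  | zero => rw [sampleMatching, PMF.mean_pure]; simp
  | succ k ih =>
    rw [sampleMatching, PMF.mean_bind]
    refine (PMF.mean_mono (F' := fun M => ρ * ∏ e ∈ M, w e) fun M hM => ?_).trans ?_
    · obtain ⟨hne, hs⟩ :=
        hstep M (Nat.lt_succ_of_le (card_le_of_mem_support_sampleMatching hM))
      rw [dif_pos hne, PMF.mean_map, PMF.mean_uniformOfFinset]
      rw [div_le_iff₀ (by exact_mod_cast hne.card_pos)]
      have h1 : ∀ e ∈ availableEdges G M,
          ((fun M => ∏ e ∈ M, w e) ∘ fun e => insert e M) e = w e * ∏ e ∈ M, w e := fun e he => by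
        rw [Function.comp_apply, Finset.prod_insert (notMem_of_mem_availableEdges he)]
      have h2 : ∑ e ∈ availableEdges G M, w e * ∏ e ∈ M, w e ≤
          ρ * (availableEdges G M).card * ∏ e ∈ M, w e := by
        rw [← Finset.sum_mul]
        exact mul_le_mul_of_nonneg_right hs (Finset.prod_nonneg fun e _ => hw e)
      calc _ = ∑ e ∈ availableEdges G M, w e * ∏ e ∈ M, w e := by
            refine Finset.sum_congr rfl fun e he => ?_
            rw [← h1 e he]
        _ ≤ _ := h2
        _ = _ := by ring
    · rw [PMF.mean_const_mul, pow_succ']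
      exact mul_le_mul_of_nonneg_left
        (ih fun M hM => hstep M (hM.trans (Nat.lt_succ_self k))) hρ

theorem availableEdges_subset (M : Finset (Sym2 (Fin n))) : availableEdges G M ⊆ G.edgeFinset := by
  classical
  exact Finset.filter_subset _ _

theorem availableEdges_nonempty (hreg : G.IsRegularOfDegree d) (hd : 1 ≤ d) (hn : 0 < n)
    {M : Finset (Sym2 (Fin n))} (hM : 2000 * d ^ 2 * M.card ≤ n) :
    (availableEdges G M).Nonempty := by
  by_contra hc
  rw [Finset.not_nonempty_iff_eq_empty] at hc
  have h1 := hreg.card_unavailable_le hd M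
  have h2 := hreg.two_mul_card_edgeFinset
  rw [hc, Finset.sdiff_empty] at h1
  have h3 := Nat.mul_le_mul_right d hM
  have h4 : 0 < n * d := Nat.mul_pos hn hd
  have h5 : 2000 * d ^ 2 * M.card * d = 2000 * (d ^ 3 * M.card) := by ring
  have h6 : 6 * d ^ 3 * M.card = 6 * (d ^ 3 * M.card) := by ring
  omega

/-- Of the `nd/2` edges at least `nd/9` cross, at most `3nd/1000` are blocked by `M'`, and at most
`n/1000` touch `M`. The gain on crossing edges outweighs the loss on touching ones. -/
theorem sum_crossWeight_le (hG : IsGoodExpander d G) (hd : 16 ≤ d) (hn : 0 < n)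
    {Y : Finset (Fin n)} (h1 : (n : ℝ) / 3 ≤ Y.card) (h2 : (Y.card : ℝ) ≤ 2 * n / 3)
    {M M' : Finset (Sym2 (Fin n))} (hM : 2000 * d ^ 2 * M.card ≤ n)
    (hM' : 2000 * d ^ 2 * M'.card ≤ n) :
    ∑ e ∈ availableEdges G M', crossWeight G Y M e ≤ 99 / 100 * (availableEdges G M').card := by
  classical
  set A := availableEdges G M' with hA
  have hAE : A ⊆ G.edgeFinset := availableEdges_subset M'
  -- A crude linear bound; `(10/9)^4 < 3` covers the touching edges.
  have hw : ∀ e, crossWeight G Y M e ≤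
      1 - (if Crosses Y e then 1 else 0) / 10 + 2 * (if Touches G M e then 1 else 0) := by
    intro e
    unfold crossWeight
    split_ifs <;> norm_num
  have hsum : ∑ e ∈ A, crossWeight G Y M e ≤
      A.card - ((A.filter (Crosses Y)).card : ℝ) / 10 + 2 * (A.filter (Touches G M)).card := by
    refine (Finset.sum_le_sum fun e _ => hw e).trans (le_of_eq ?_)
    rw [Finset.sum_add_distrib, Finset.sum_sub_distrib, ← Finset.sum_div, ← Finset.mul_sum,
      Finset.sum_boole, Finset.sum_boole]
    simp
  have hX := hG.card_crosses_ge hd hn h1 h2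
  have hXA : (G.edgeFinset.filter (Crosses Y)).card ≤
      (A.filter (Crosses Y)).card + (G.edgeFinset \ A).card := by
    refine (Finset.card_le_card ?_).trans (Finset.card_union_le _ _)
    intro e he
    obtain ⟨he, hc⟩ := Finset.mem_filter.1 he
    by_cases heA : e ∈ A
    · exact Finset.mem_union_left _ (Finset.mem_filter.2 ⟨heA, hc⟩)
    · exact Finset.mem_union_right _ (Finset.mem_sdiff.2 ⟨he, heA⟩)
  have hU := hG.1.card_unavailable_le (by omega) M'
  rw [← hA] at hU
  have hT := (Finset.card_le_card (Finset.filter_subset_filter (Touches G M) hAE)).trans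
    (hG.1.card_touches_le M)
  have hE := hG.1.two_mul_card_edgeFinset
  have hAc := Finset.card_le_card hAE
  have hM'' := Nat.mul_le_mul_right d hM'
  have e1 : 2000 * d ^ 2 * M'.card * d = 2000 * (d ^ 3 * M'.card) := by ring
  have e2 : 6 * d ^ 3 * M'.card = 6 * (d ^ 3 * M'.card) := by ring
  have e3 : 2000 * d ^ 2 * M.card = 2000 * (d ^ 2 * M.card) := by ring
  have e4 : 2 * d ^ 2 * M.card = 2 * (d ^ 2 * M.card) := by ring
  have hnd : 16 * n ≤ n * d := by nlinarith
  have hX' : n * d ≤ 9 * (G.edgeFinset.filter (Crosses Y)).card := by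
    rw [mul_comm]; exact_mod_cast hX
  have hfin : A.card + 200 * (A.filter (Touches G M)).card ≤ 10 * (A.filter (Crosses Y)).card := by
    omega
  have hfin' : (A.card : ℝ) + 200 * (A.filter (Touches G M)).card ≤
      10 * (A.filter (Crosses Y)).card := by exact_mod_cast hfin
  linarith

end Sampling

/-! ### Exchanging the two sides of independent samples -/

theorem edgeFactor_mk {n : ℕ} (S : Finset (Fin n)) {y z : Fin n} (h : y ≠ z) :
    edgeFactor S s(y, z) =
      if y ∈ S then (if z ∈ S then 5 / 2 else 3 / 2) else (if z ∈ S then 3 / 2 else 1) := by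
  have h1 : S.filter (· ∈ s(y, z)) = ({y, z} : Finset (Fin n)).filter (· ∈ S) := by
    ext i
    simp [Sym2.mem_iff, and_comm]
  rw [edgeFactor, h1, Finset.filter_insert, Finset.filter_singleton]
  split_ifs <;> norm_num [h]

/-- Agrees with `S` on `Y` and with `S'` outside of `Y`. -/
def mixSet {n : ℕ} (Y S S' : Finset (Fin n)) : Finset (Fin n) := (S ∩ Y) ∪ (S' ∩ Yᶜ)

theorem mem_mixSet {n : ℕ} {Y S S' : Finset (Fin n)} {i : Fin n} :
    i ∈ mixSet Y S S' ↔ if i ∈ Y then i ∈ S else i ∈ S' := by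
  by_cases h : i ∈ Y <;> simp [mixSet, h]

/-- The number of orientations of `e` that lead from `S'` to `S`. -/
def orientationCount {n : ℕ} (S' S : Finset (Fin n)) (e : Sym2 (Fin n)) : ℕ :=
  ((S' ×ˢ S).filter fun p => s(p.1, p.2) = e).card

theorem le_orientationCount {n : ℕ} (S' S : Finset (Fin n)) {y z : Fin n} (h : y ≠ z) :
    (if y ∈ S' ∧ z ∈ S then 1 else 0) + (if z ∈ S' ∧ y ∈ S then 1 else 0) ≤
      orientationCount S' S s(y, z) := by
  have h1 : (({(y, z), (z, y)} : Finset (Fin n × Fin n)).filter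
      fun p => p.1 ∈ S' ∧ p.2 ∈ S).card ≤ orientationCount S' S s(y, z) := by
    refine Finset.card_le_card fun p hp => ?_
    simp only [Finset.mem_filter, Finset.mem_insert, Finset.mem_singleton] at hp
    rcases hp.1 with rfl | rfl
    · exact Finset.mem_filter.2 ⟨Finset.mem_product.2 hp.2, rfl⟩
    · exact Finset.mem_filter.2 ⟨Finset.mem_product.2 hp.2, Sym2.eq_swap⟩
  refine le_trans ?_ h1
  rw [Finset.filter_insert, Finset.filter_singleton]
  split_ifs <;> simp_all

-- Only edges across the cut change. The worst quotient, `(1 · 5/2) / (3/2)² = 10/9`, occurs when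
-- `S` and `S'` contain opposite end points, which gives an orientation from `S'` to `S`. For a
-- crossing edge of `M'`, both ends lie in `S'`: the quotient is `9/10` if `S` misses it, and
-- otherwise it is `1` and an orientation pays for the lost `9/10`.
open Classical in
theorem edgeFactor_mixSet_le {n : ℕ} (Y S : Finset (Fin n)) (M' : Finset (Sym2 (Fin n)))
    {e : Sym2 (Fin n)} (he : ¬ e.IsDiag) :
    edgeFactor (mixSet Y S (vertexSet M')) e * edgeFactor (mixSet Y (vertexSet M') S) e ≤
      edgeFactor S e * edgeFactor (vertexSet M') e *
        ((10 / 9) ^ orientationCount (vertexSet M') S e *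
          if e ∈ M' then (if Crosses Y e then 9 / 10 else 1) else 1) := by
  induction e with
  | _ y z =>
    have hyz : y ≠ z := fun h => he (Sym2.mk_isDiag_iff.2 h)
    set S' := vertexSet M' with hS'
    have h1 := pow_le_pow_right₀ (by norm_num : (1 : ℝ) ≤ 10 / 9) (le_orientationCount S' S hyz)
    have hc : Crosses Y s(y, z) ↔ (y ∈ Y ∧ z ∉ Y) ∨ (z ∈ Y ∧ y ∉ Y) := by
      simp only [Crosses, Sym2.mem_iff]
      constructor
      · rintro ⟨a, rfl | rfl, b, rfl | rfl, ha, hb⟩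
        · exact absurd ha hb
        · exact .inl ⟨ha, hb⟩
        · exact .inr ⟨ha, hb⟩
        · exact absurd ha hb
      · rintro (⟨ha, hb⟩ | ⟨ha, hb⟩)
        · exact ⟨y, .inl rfl, z, .inr rfl, ha, hb⟩
        · exact ⟨z, .inr rfl, y, .inl rfl, ha, hb⟩
    have hmem : s(y, z) ∈ M' → y ∈ S' ∧ z ∈ S' := fun h =>
      ⟨mem_vertexSet.2 ⟨_, h, Sym2.mem_mk_left y z⟩, mem_vertexSet.2 ⟨_, h, Sym2.mem_mk_right y z⟩⟩
    have hpos := mul_pos (edgeFactor_pos S s(y, z)) (edgeFactor_pos S' s(y, z))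
    refine le_trans ?_ (mul_le_mul_of_nonneg_left (mul_le_mul_of_nonneg_right h1 ?_) hpos.le)
    · rw [edgeFactor_mk _ hyz, edgeFactor_mk _ hyz, edgeFactor_mk _ hyz, edgeFactor_mk _ hyz]
      simp only [mem_mixSet, hc]
      by_cases hM : s(y, z) ∈ M'
      · obtain ⟨hy, hz⟩ := hmem hM
        by_cases a : y ∈ S <;> by_cases b : z ∈ S <;> by_cases c : y ∈ Y <;>
          by_cases c' : z ∈ Y <;> simp only [hM, hy, hz, a, b, c, c'] <;> norm_num
      · by_cases hy : y ∈ S' <;> by_cases hz : z ∈ S' <;> by_cases a : y ∈ S <;>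
          by_cases b : z ∈ S <;> by_cases c : y ∈ Y <;> by_cases c' : z ∈ Y <;>
          simp only [hM, hy, hz, a, b, c, c'] <;> norm_num
    · split_ifs <;> norm_num

/-! ### Comparing coefficients before and after the exchange -/

section Exchange

variable {n d : ℕ} {G : SimpleGraph (Fin n)} [DecidableRel G.Adj]

/-- Two neighbours of `x` have distance at most `2`, so those in `V(M)` lie on a single edge of `M`.
-/
theorem IsDistanceThreeMatching.card_neighbors_le {M : Finset (Sym2 (Fin n))}
    (hM : IsDistanceThreeMatching G M) (x : Fin n) :
    ((vertexSet M).filter fun u => G.Adj x u).card ≤ 2 := by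
  rcases ((vertexSet M).filter fun u => G.Adj x u).eq_empty_or_nonempty with h | ⟨u, hu⟩
  · simp [h]
  obtain ⟨hu, hxu⟩ := Finset.mem_filter.1 hu
  obtain ⟨e, he, hue⟩ := mem_vertexSet.1 hu
  have hsub : ((vertexSet M).filter fun u => G.Adj x u) ⊆ e.toFinset := by
    intro v hv
    obtain ⟨hv, hxv⟩ := Finset.mem_filter.1 hv
    obtain ⟨f, hf, hvf⟩ := mem_vertexSet.1 hv
    by_cases hef : e = f
    · subst hef; exact Sym2.mem_toFinset.2 hvf
    · have h3 := hM.2 e he f hf hef u hue v hvf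
      have h2 : G.edist u v ≤ 2 := by
        have := G.edist_triangle (u := u) (v := x) (w := v)
        rw [SimpleGraph.edist_eq_one_iff_adj.2 hxu.symm, SimpleGraph.edist_eq_one_iff_adj.2 hxv,
          one_add_one_eq_two] at this
        exact this
      exact absurd (h3.trans h2) (by decide)
  refine (Finset.card_le_card hsub).trans ?_
  rw [Sym2.card_toFinset]
  split_ifs <;> omega

-- This is the source of the exponent `4` in `crossWeight`: a touching edge of `M'` has two ends,
-- each with at most two neighbours in `V(M)`.
open Classical in
theorem IsDistanceThreeMatching.sum_orientationCount_le {M : Finset (Sym2 (Fin n))}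
    (hM : IsDistanceThreeMatching G M) (M' : Finset (Sym2 (Fin n))) :
    ∑ e ∈ G.edgeFinset, orientationCount (vertexSet M') (vertexSet M) e ≤
      4 * (M'.filter (Touches G M)).card := by
  set P := (vertexSet M' ×ˢ vertexSet M).filter fun p => G.Adj p.1 p.2 with hP
  have h1 : ∑ e ∈ G.edgeFinset, orientationCount (vertexSet M') (vertexSet M) e = P.card := by
    rw [Finset.card_eq_sum_card_fiberwise (f := fun p : Fin n × Fin n => s(p.1, p.2))
      (t := G.edgeFinset)]
    · refine Finset.sum_congr rfl fun e he => ?_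
      rw [orientationCount, hP, Finset.filter_filter]
      congr 1
      refine Finset.filter_congr fun p _ => ⟨fun h => ⟨?_, h⟩, fun h => h.2⟩
      rw [← h] at he
      exact SimpleGraph.mem_edgeFinset.1 he
    · intro p hp
      exact SimpleGraph.mem_edgeFinset.2 (Finset.mem_filter.1 hp).2
  have h2 : P ⊆ (M'.filter (Touches G M)).biUnion fun e => e.toFinset.biUnion fun x =>
      ((vertexSet M).filter fun u => G.Adj x u).image fun u => (x, u) := by
    rintro ⟨x, u⟩ hp
    obtain ⟨hp, hxu⟩ := Finset.mem_filter.1 hp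
    obtain ⟨hx, hu⟩ := Finset.mem_product.1 hp
    obtain ⟨e, he, hxe⟩ := mem_vertexSet.1 hx
    exact Finset.mem_biUnion.2 ⟨e, Finset.mem_filter.2 ⟨he, x, hxe, u, hu, hxu.symm⟩,
      Finset.mem_biUnion.2 ⟨x, Sym2.mem_toFinset.2 hxe,
        Finset.mem_image.2 ⟨u, Finset.mem_filter.2 ⟨hu, hxu⟩, rfl⟩⟩⟩
  rw [h1, mul_comm]
  refine (Finset.card_le_card h2).trans (Finset.card_biUnion_le_card_mul _ _ _ fun e _ => ?_)
  refine (Finset.card_biUnion_le_card_mul _ _ 2 fun x _ =>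
    Finset.card_image_le.trans (hM.card_neighbors_le x)).trans ?_
  rw [Sym2.card_toFinset]
  split_ifs <;> omega

/-- Exchanging the parts outside of `Y` of two samples changes the product of their coefficients
by at most a product of edge weights. -/
theorem coeffSet_mixSet_le {M M' : Finset (Sym2 (Fin n))} (hM : IsDistanceThreeMatching G M)
    (hM' : IsDistanceThreeMatching G M') (Y : Finset (Fin n)) :
    coeffSet (mixSet Y (vertexSet M) (vertexSet M')) (hardPoly G) *
        coeffSet (mixSet Y (vertexSet M') (vertexSet M)) (hardPoly G) ≤
      coeffSet (vertexSet M) (hardPoly G) * coeffSet (vertexSet M') (hardPoly G) *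
        ∏ e ∈ M', crossWeight G Y M e := by
  classical
  simp only [coeffSet_hardPoly, ← Finset.prod_mul_distrib]
  have hsub : M' ⊆ G.edgeFinset := fun e he => SimpleGraph.mem_edgeFinset.2 (hM'.1 e he)
  refine (Finset.prod_le_prod (fun e _ => (mul_pos (edgeFactor_pos _ e) (edgeFactor_pos _ e)).le)
    fun e he => edgeFactor_mixSet_le Y (vertexSet M) M'
      (G.not_isDiag_of_mem_edgeFinset he)).trans ?_
  rw [Finset.prod_mul_distrib]
  refine mul_le_mul_of_nonneg_left ?_
    (Finset.prod_nonneg fun e _ => (mul_pos (edgeFactor_pos _ e) (edgeFactor_pos _ e)).le)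
  rw [Finset.prod_mul_distrib, Finset.prod_pow_eq_pow_sum, Finset.prod_ite_mem,
    Finset.inter_eq_right.2 hsub, mul_comm]
  simp only [crossWeight, Finset.prod_mul_distrib]
  refine mul_le_mul_of_nonneg_left ?_ (Finset.prod_nonneg fun e _ => by positivity)
  rw [← Finset.prod_filter, Finset.prod_const, ← pow_mul]
  exact pow_le_pow_right₀ (by norm_num) (hM.sum_orientationCount_le M')

end Exchange

/-! ### The bound on product pairs and on circuit size -/

theorem expectation_sampleVertexSet {n : ℕ} (G : SimpleGraph (Fin n)) [DecidableRel G.Adj] (k : ℕ)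
    (F : Finset (Fin n) → ℝ) :
    expectation (sampleVertexSet G k) F = (sampleMatching G k).mean fun M => F (vertexSet M) :=
  PMF.mean_map _ _ _

/-- The squared expected ratio of a product pair dominated by the hard polynomial decays
exponentially in the number of sampled edges. -/
theorem sq_expectation_le {n d k : ℕ} {G : SimpleGraph (Fin n)} [DecidableRel G.Adj]
    (hG : IsGoodExpander d G) (hd : 16 ≤ d) (hn : 0 < n) (hk : 2000 * d ^ 2 * k ≤ n)
    {g h : MvPolynomial (Fin n) ℝ} (hgh : IsNonnegProductPair g h)
    (hle : ∀ S : Finset (Fin n), coeffSet S (g * h) ≤ coeffSet S (hardPoly G)) :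
    expectation (sampleVertexSet G k)
      (fun S => coeffSet S (g * h) / coeffSet S (hardPoly G)) ^ 2 ≤ (99 / 100) ^ k := by
  obtain ⟨-, -, hg0, hh0, Y, Z, hYZ, hu, hY1, hY2, -, -, hgY, hhZ⟩ := hgh
  have hZ : Z = Yᶜ := by
    ext i
    rw [Finset.mem_compl]
    refine ⟨fun hi hiY => Finset.disjoint_left.1 hYZ hiY hi, fun hi => ?_⟩
    have : i ∈ Y ∪ Z := hu ▸ Finset.mem_univ i
    exact (Finset.mem_union.1 this).resolve_left hi
  subst hZ
  set F : Finset (Sym2 (Fin n)) → ℝ := fun M =>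
    coeffSet (vertexSet M) (g * h) / coeffSet (vertexSet M) (hardPoly G) with hF
  set p := sampleMatching G k with hp
  have hpair : ∀ M ∈ p.support, ∀ M' ∈ p.support, F M * F M' ≤ ∏ e ∈ M', crossWeight G Y M e := by
    intro M hM M' hM'
    have h1 := coeffSet_mixSet_le (isDistanceThreeMatching_of_mem_support hM)
      (isDistanceThreeMatching_of_mem_support hM') Y
    set S := vertexSet M
    set S' := vertexSet M'
    have hmul := coeffSet_mul hYZ hu hgY hhZ
    have e1 : ∀ S S' : Finset (Fin n), mixSet Y S S' ∩ Y = S ∩ Y := fun S S' => by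
      ext i; by_cases hi : i ∈ Y <;> simp [mem_mixSet, hi]
    have e2 : ∀ S S' : Finset (Fin n), mixSet Y S S' ∩ Yᶜ = S' ∩ Yᶜ := fun S S' => by
      ext i; by_cases hi : i ∈ Y <;> simp [mem_mixSet, hi]
    have h2 : coeffSet S (g * h) * coeffSet S' (g * h) =
        coeffSet (mixSet Y S S') (g * h) * coeffSet (mixSet Y S' S) (g * h) := by
      simp only [hmul, e1, e2]
      ring
    have h3 : coeffSet (mixSet Y S S') (g * h) * coeffSet (mixSet Y S' S) (g * h) ≤
        coeffSet (mixSet Y S S') (hardPoly G) * coeffSet (mixSet Y S' S) (hardPoly G) :=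
      mul_le_mul (hle _) (hle _) ((hg0.mul hh0) _) (coeffSet_hardPoly_pos G _).le
    have hpos := mul_pos (coeffSet_hardPoly_pos G S) (coeffSet_hardPoly_pos G S')
    rw [hF, div_mul_div_comm, div_le_iff₀ hpos, h2, mul_comm (∏ e ∈ M', _)]
    exact h3.trans h1
  have hcard : ∀ {M}, M ∈ p.support → 2000 * d ^ 2 * M.card ≤ n := fun hM =>
    (Nat.mul_le_mul_left _ (card_le_of_mem_support_sampleMatching hM)).trans hk
  rw [expectation_sampleVertexSet, sq]
  calc p.mean F * p.mean F = p.mean fun M => p.mean fun M' => F M * F M' := by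
        simp only [PMF.mean_const_mul]
        rw [← PMF.mean_const_mul]
        congr 1
        funext M
        exact mul_comm _ _
    _ ≤ p.mean fun _ => (99 / 100) ^ k := by
        -- Here `M` is fixed, so the bound is a product weight in `M'` alone and the stepwise
        -- estimate applies.
        refine PMF.mean_mono fun M hM => (PMF.mean_mono fun M' hM' => hpair M hM M' hM').trans ?_
        refine mean_sampleMatching_prod_le (crossWeight_nonneg G Y M) (by norm_num)
          fun M' hM' => ?_
        have hM'c := (Nat.mul_le_mul_left (2000 * d ^ 2) hM'.le).trans hk
        exact ⟨availableEdges_nonempty hG.1 (by omega) hn hM'c,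
          sum_crossWeight_le hG hd hn hY1 hY2 (hcard hM) hM'c⟩
    _ = _ := PMF.mean_const _ _

/-- For `αn ≥ 4` the floor exceeds `αn/2 - 1 ≥ αn/4`. With `99/100 ≤ e^(-1/100)` the squared bound
is `e^(-αn/400)`; the square root gives `α/800`. -/
theorem expectation_le_exp {n d : ℕ} {G : SimpleGraph (Fin n)} [DecidableRel G.Adj]
    (hG : IsGoodExpander d G) (hd : 16 ≤ d) {α : ℝ} (hα : 0 < α) (hn : 4 / α ≤ n)
    (hk : 2000 * d ^ 2 * ⌊α * n / 2⌋₊ ≤ n)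
    {g h : MvPolynomial (Fin n) ℝ} (hgh : IsNonnegProductPair g h)
    (hle : ∀ S : Finset (Fin n), coeffSet S (g * h) ≤ coeffSet S (hardPoly G)) :
    expectation (sampleVertexSet G ⌊α * n / 2⌋₊)
      (fun S => coeffSet S (g * h) / coeffSet S (hardPoly G)) ≤ Real.exp (-(α / 800 * n)) := by
  have hn0 : (0 : ℝ) < n := (by positivity : 0 < 4 / α).trans_le hn
  have h1 := sq_expectation_le hG hd (by exact_mod_cast hn0) hk hgh hle
  have hαn : 4 ≤ α * n := by rwa [div_le_iff₀' hα] at hn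
  have hfl := Nat.sub_one_lt_floor (α * n / 2)
  have h2 : ((99 : ℝ) / 100) ^ ⌊α * n / 2⌋₊ ≤ Real.exp (-(α / 800 * n)) ^ 2 := by
    have h3 : (99 : ℝ) / 100 ≤ Real.exp (-(1 / 100)) := by
      have := Real.add_one_le_exp (-(1 / 100 : ℝ))
      linarith
    refine (pow_le_pow_left₀ (by norm_num) h3 _).trans ?_
    rw [← Real.exp_nat_mul, ← Real.exp_nat_mul, Real.exp_le_exp]
    push_cast
    linarith
  exact le_of_sq_le_sq (h1.trans h2) (Real.exp_pos _).le

theorem two_thousand_mul_floor_le {n d : ℕ} (hd : 0 < d) {α : ℝ} (hα : 0 < α)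
    (hα' : α ≤ 1 / 1000 / (d : ℝ) ^ 2) : 2000 * d ^ 2 * ⌊α * n / 2⌋₊ ≤ n := by
  have hd' : (0 : ℝ) < (d : ℝ) ^ 2 := by positivity
  have h1 := Nat.floor_le (by positivity : 0 ≤ α * n / 2)
  rw [le_div_iff₀ hd'] at hα'
  have h2 := mul_le_mul_of_nonneg_left h1 (by positivity : (0 : ℝ) ≤ 2000 * (d : ℝ) ^ 2)
  have h3 := mul_le_mul_of_nonneg_right hα' (Nat.cast_nonneg (α := ℝ) n)
  have h4 : (2000 : ℝ) * (d : ℝ) ^ 2 * ⌊α * n / 2⌋₊ ≤ n := by linarith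
  exact_mod_cast h4

theorem coeffSet_list_sum {n : ℕ} (S : Finset (Fin n)) (L : List (MvPolynomial (Fin n) ℝ)) :
    coeffSet S L.sum = (L.map (coeffSet S)).sum := by
  induction L with
  | nil => simp [coeffSet]
  | cons p L ih => rw [List.sum_cons, coeffSet_add, ih, List.map_cons, List.sum_cons]

theorem expectation_list_sum {n : ℕ} {ι : Type*} (μ : PMF (Finset (Fin n)))
    (F : ι → Finset (Fin n) → ℝ) (L : List ι) :
    expectation μ (fun S => (L.map fun i => F i S).sum) = (L.map fun i => expectation μ (F i)).sum := by
  induction L with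
  | nil => simp [expectation]
  | cons i L ih =>
    simp only [List.map_cons, List.sum_cons]
    rw [← ih]
    simp only [expectation, mul_add, Finset.sum_add_distrib]

/-- A distribution under which every dominated product pair has a small expected ratio gives a
lower bound on the size of monotone circuits. -/
theorem AlgCircuit.IsMonotone.one_le_size_mul {n : ℕ} {C : AlgCircuit n} (hC : C.IsMonotone)
    (hn : 3 ≤ n) {P : MvPolynomial (Fin n) ℝ} (hP : C.eval = P) (hml : IsMultilinear P)
    (hpos : ∀ S, 0 < coeffSet S P) (μ : PMF (Finset (Fin n))) {ε : ℝ} (hε : 0 ≤ ε)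
    (hμ : ∀ g h : MvPolynomial (Fin n) ℝ, IsNonnegProductPair g h →
      (∀ S, coeffSet S (g * h) ≤ coeffSet S P) →
      expectation μ (fun S => coeffSet S (g * h) / coeffSet S P) ≤ ε) :
    1 ≤ ((C.size : ℝ) + 1) * ε := by
  subst hP
  obtain ⟨L, hL, hLp, hLs⟩ := hC.exists_decomposition hn hml
  have hcoeff : ∀ S, coeffSet S C.eval = (L.map fun p => coeffSet S (p.1 * p.2)).sum := fun S => by
    conv_lhs => rw [hLs]
    rw [coeffSet_list_sum, List.map_map]
    rfl
  have hdom : ∀ p ∈ L, ∀ S, coeffSet S (p.1 * p.2) ≤ coeffSet S C.eval := by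
    intro p hp S
    rw [hcoeff S]
    refine List.single_le_sum ?_ _ (List.mem_map_of_mem hp)
    intro x hx
    obtain ⟨q, hq, rfl⟩ := List.mem_map.1 hx
    exact ((hLp q hq).2.2.1.mul (hLp q hq).2.2.2.1) _
  -- The ratios of all pairs sum to `1` at every `S`, hence also on average.
  have h1 : (1 : ℝ) = (L.map fun p =>
      expectation μ fun S => coeffSet S (p.1 * p.2) / coeffSet S C.eval).sum := by
    rw [← expectation_list_sum]
    rw [← PMF.mean_const μ (1 : ℝ)]
    refine Finset.sum_congr rfl fun S _ => ?_
    congr 1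
    have h2 : (L.map fun p => coeffSet S (p.1 * p.2) / coeffSet S C.eval).sum =
        (L.map fun p => coeffSet S (p.1 * p.2)).sum / coeffSet S C.eval := by
      simp only [div_eq_mul_inv]
      rw [List.sum_map_mul_right]
    beta_reduce
    rw [h2, ← hcoeff S, div_self (hpos S).ne']
  refine h1.le.trans ?_
  calc _ ≤ (L.map fun p =>
        expectation μ fun S => coeffSet S (p.1 * p.2) / coeffSet S C.eval).length • ε := by
        refine List.sum_le_card_nsmul _ _ fun x hx => ?_
        obtain ⟨p, hp, rfl⟩ := List.mem_map.1 hx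
        exact hμ p.1 p.2 (hLp p hp) (hdom p hp)
    _ = (L.length : ℝ) * ε := by rw [List.length_map, nsmul_eq_mul]
    _ ≤ ((C.size : ℝ) + 1) * ε := by
        refine mul_le_mul_of_nonneg_right ?_ hε
        exact_mod_cast hL

/-- With `t = e^(x/2) ≥ 2`, the bound `t² ≤ s + 1` gives `t ≤ t² - 1 ≤ s`. Halving the exponent thus
absorbs the `+ 1`. -/
theorem two_rpow_le_of_one_le_mul_exp {s x : ℝ} (hx : 2 ≤ x) (h : 1 ≤ (s + 1) * Real.exp (-x)) :
    (2 : ℝ) ^ (x / 2) ≤ s := by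
  have h1 : Real.exp x ≤ s + 1 := by
    rw [Real.exp_neg, ← div_eq_mul_inv, le_div_iff₀ (Real.exp_pos x), one_mul] at h
    exact h
  have h2 : Real.exp x = Real.exp (x / 2) * Real.exp (x / 2) := by
    rw [← Real.exp_add]; ring_nf
  have h3 := Real.add_one_le_exp (x / 2)
  have h4 : (2 : ℝ) ^ (x / 2) ≤ Real.exp (x / 2) := by
    rw [← Real.exp_one_rpow (x / 2)]
    refine Real.rpow_le_rpow (by norm_num) ?_ (by linarith)
    have := Real.add_one_le_exp (1 : ℝ)
    linarith
  nlinarith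

theorem mainTheorem2 :
    ∃ (κ : ℝ) (d₀ : ℕ), 0 < κ ∧ ∀ d : ℕ, d₀ ≤ d →
      -- the circuit lower bound
      (∃ (c : ℝ) (n₀ : ℕ), 0 < c ∧
        ∀ (n : ℕ) (G : SimpleGraph (Fin n)) [DecidableRel G.Adj],
          n₀ ≤ n → IsGoodExpander d G →
          ∀ C : AlgCircuit n, C.IsMonotone → C.eval = hardPoly G →
            (2 : ℝ) ^ (c * n) ≤ C.size) ∧
      -- the bound on product pairs under the explicit distribution
      (∀ α : ℝ, 0 < α → α ≤ κ / (d : ℝ) ^ 2 →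
        ∃ (c : ℝ) (n₀ : ℕ), 0 < c ∧
          ∀ (n : ℕ) (G : SimpleGraph (Fin n)) [DecidableRel G.Adj],
            n₀ ≤ n → IsGoodExpander d G →
            (∀ M ∈ (sampleMatching G ⌊α * n / 2⌋₊).support,
              IsDistanceThreeMatching G M ∧ M.card = ⌊α * n / 2⌋₊) ∧
            (∀ S : Finset (Fin n), 0 < coeffSet S (hardPoly G)) ∧
            ∀ g h : MvPolynomial (Fin n) ℝ, IsNonnegProductPair g h →
              (∀ S : Finset (Fin n), coeffSet S (g * h) ≤ coeffSet S (hardPoly G)) →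
              expectation (sampleVertexSet G ⌊α * n / 2⌋₊)
                  (fun S => coeffSet S (g * h) / coeffSet S (hardPoly G))
                ≤ Real.exp (-(c * n))) := by
  -- `κ = 1/1000` makes `2000 d² k ≤ n`; `16` is where the spectral gap reaches `d/2`.
  refine ⟨1 / 1000, 16, by norm_num, fun d hd => ?_⟩
  have hd0 : 0 < d := by omega
  refine ⟨?_, fun α hα hα' => ⟨α / 800, ⌈4 / α⌉₊, by positivity, fun n G _ hn hG => ?_⟩⟩
  · set α : ℝ := 1 / 1000 / (d : ℝ) ^ 2 with hαdef
    have hα : 0 < α := by positivity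
    -- `n ≥ 1600/α` makes the exponent `αn/800` at least `2`; `n ≥ 3` is needed for balanced gates.
    refine ⟨α / 1600, max 3 ⌈1600 / α⌉₊, by positivity, fun n G _ hn hG C hC hCP => ?_⟩
    have hn' : 1600 / α ≤ n := Nat.ceil_le.1 ((le_max_right _ _).trans hn)
    have hn4 : 4 / α ≤ n := le_trans (by gcongr; norm_num) hn'
    have h := hC.one_le_size_mul ((le_max_left _ _).trans hn) hCP (isMultilinear_hardPoly G)
      (coeffSet_hardPoly_pos G) _ (Real.exp_pos _).le fun g h hgh hle =>
        expectation_le_exp hG hd hα hn4 (two_thousand_mul_floor_le hd0 hα le_rfl) hgh hle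
    rw [div_le_iff₀ hα] at hn'
    have h2 := two_rpow_le_of_one_le_mul_exp (by linarith) h
    rwa [show α / 800 * n / 2 = α / 1600 * n by ring] at h2
  · have hn4 : 4 / α ≤ n := Nat.ceil_le.1 hn
    have hk := two_thousand_mul_floor_le (n := n) hd0 hα hα'
    have hn0 : 0 < n := by exact_mod_cast (by positivity : 0 < 4 / α).trans_le hn4
    refine ⟨fun M hM => ⟨isDistanceThreeMatching_of_mem_support hM,
      card_eq_of_mem_support_sampleMatching (fun M' hM' => ?_) hM⟩, coeffSet_hardPoly_pos G,
      fun g h hgh hle => expectation_le_exp hG hd hα hn4 hk hgh hle⟩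
    exact availableEdges_nonempty hG.1 hd0 hn0
      ((Nat.mul_le_mul_left (2000 * d ^ 2) hM'.le).trans hk)
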